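/- Setting. Let $Z,Z_1,Z_2,\dots$ be i.i.d. with law $P$, $\mathcal D_n=\{Z_1,\dots,Z_n\}$, let $\Theta\subset\mathbb R^d$ be the parameter set and $m(z,\theta)$ a real function, twice differentiable in $\theta\in\Theta$, with gradient $\dot m$ and Hessian $\ddot m$ in $\theta$. Put $M(\theta)=E\{m(Z,\theta)\}$ with Hessian $\ddot M$, let $\theta_0$ be the maximizer of $M$ over $\Theta$, assumed to be an interior point of $\Theta$, and let $\hat\theta_n$ be a maximizer over $\Theta$ of $M_n(\theta)=\frac1n\sum_{i=1}^n m(Z_i,\theta)$. Poisson subsampling. Let $s_n<n$ (for large $n$) be expected subsample sizes with $s_n\to\infty$ as $n\to\infty$. Let $\pi_{n,1},\dots,\pi_{n,n}>0$ be measurable functions of $\mathcal D_n$ with $\sum_{i=1}^n\pi_{n,i}=1$ and $s_n\pi_{n,i}\le 1$. Given i.i.d. $u_{n,1},\dots,u_{n,n}\sim U(0,1)$ independent of $\mathcal D_n$, the index $i$ is included in the subsample $S_n$ if and only if $u_{n,i}\le s_n\pi_{n,i}$; let $s_n^*=|S_n|$, and let the (measurable) estimator $\tilde\theta_{s_n,P}$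 be a maximizer over $\theta\in\Theta$ of $\sum_{i\in S_n}\frac{m(Z_i,\theta)}{n s_n^*\pi_{n,i}}$ (an empty sum being $0$). Assumptions. (1) $\Theta$ is compact. (2) $m(z,\cdot)$ is concave on the convex set $\Theta$ for every $z$, $E\{m^2(Z,\theta)\}<\infty$ for every $\theta\in\Theta$, and the maximizer $\theta_0$ of $M$ over $\Theta$ is unique. (3) For every $\theta\in\Theta$, $-E\{\ddot m(Z,\theta)\}$ is positive definite and $E\{\ddot m_{k,l}^2(Z,\theta)\}<\infty$ for all $k,l$; and there is $\psi$ with $E\{\psi^2(Z)\}<\infty$ such that $|\ddot m_{k,l}(z,\theta_1)-\ddot m_{k,l}(z,\theta_2)|\le\psi(z)\|\theta_1-\theta_2\|$ for all $z$, all $\theta_1,\theta_2\in\Theta$ and all $k,l$. (4) For every $\theta\in\Theta$, $\Lambda(\theta)=E\{\dot m(Z,\theta)\dot m^{\mathrm T}(Z,\theta)\}$ exists and is positive definite; and for some $\delta>0$, $\frac1n\sum_{i=1}^n\|\dot m(Z_i,\theta)\|^4=O_P(1)$ for $\theta$ in the $\delta$-neighborhood of $\hat\theta_n$, in the sense that for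 every $\theta\in\Theta$ the product of this average with the indicator of $\|\theta-\hat\theta_n\|<\delta$ is $O_P(1)$. (5) $\max_{1\le i\le n}(n\pi_{n,i})^{-1}=O_P(1)$. Theorem. If, as $n\to\infty$ (and $s_n\to\infty$), $$\Lambda_{n,R}(\theta_0)=\frac1{n^2}\sum_{i=1}^n\frac{\dot m(Z_i,\theta_0)\dot m^{\mathrm T}(Z_i,\theta_0)}{\pi_{n,i}}$$ converges in probability to a positive-definite matrix $\Lambda_\pi(\theta_0)$, then, unconditionally, $$\sqrt{s_n}\,(\tilde\theta_{s_n,P}-\theta_0)\rightsquigarrow N\big(0,\ \ddot M^{-1}(\theta_0)\Lambda_\pi(\theta_0)\ddot M^{-1}(\theta_0)\big).$$ -/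

import Mathlib

open MeasureTheory ProbabilityTheory Filter Topology

noncomputable section

namespace Subsampling

/-- The Hessian matrix of `f` at `θ`, all derivatives being taken within `Θ`. -/
def hessian {d : ℕ} (Θ : Set (EuclideanSpace ℝ (Fin d))) (f : EuclideanSpace ℝ (Fin d) → ℝ)
    (θ : EuclideanSpace ℝ (Fin d)) : Matrix (Fin d) (Fin d) ℝ :=
  Matrix.of fun k l =>
    (fderivWithin ℝ (gradientWithin f Θ) Θ θ (EuclideanSpace.single l 1)) k

/-- The outer product `v vᵀ`. -/
def outer {d : ℕ} (v : EuclideanSpace ℝ (Fin d)) : Matrix (Fin d) (Fin d) ℝ :=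
  Matrix.of fun k l => v k * v l

/-- `X n = O_P(1)`: boundedness in probability. -/
def BoundedInProb {Ω : Type*} [MeasurableSpace Ω] (μ : Measure Ω) (X : ℕ → Ω → ℝ) : Prop :=
  ∀ ε : ℝ, 0 < ε → ∃ K : ℝ, ∀ᶠ n in atTop, μ {ω | K < |X n ω|} ≤ ENNReal.ofReal ε

section Population

variable {𝒵 : Type*} [MeasurableSpace 𝒵] {d : ℕ}

/-- The population target `M(θ) = E m(Z, θ)`, where `Z ∼ P`. -/
def popTarget (P : Measure 𝒵) (m : 𝒵 → EuclideanSpace ℝ (Fin d) → ℝ)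
    (θ : EuclideanSpace ℝ (Fin d)) : ℝ :=
  ∫ z, m z θ ∂P

/-- The matrix `E m̈(Z, θ)`. -/
def expectedHessian (P : Measure 𝒵) (Θ : Set (EuclideanSpace ℝ (Fin d)))
    (m : 𝒵 → EuclideanSpace ℝ (Fin d) → ℝ) (θ : EuclideanSpace ℝ (Fin d)) :
    Matrix (Fin d) (Fin d) ℝ :=
  Matrix.of fun k l => ∫ z, hessian Θ (m z) θ k l ∂P

/-- The matrix `Λ(θ) = E {ṁ(Z, θ) ṁ(Z, θ)ᵀ}`. -/
def scoreCov (P : Measure 𝒵) (Θ : Set (EuclideanSpace ℝ (Fin d)))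
    (m : 𝒵 → EuclideanSpace ℝ (Fin d) → ℝ) (θ : EuclideanSpace ℝ (Fin d)) :
    Matrix (Fin d) (Fin d) ℝ :=
  Matrix.of fun k l => ∫ z, outer (gradientWithin (m z) Θ θ) k l ∂P

/-- Concavity of `m(z, ·)` on the parameter set, and `E m²(Z, θ) < ∞`. -/
structure ConcaveTarget (P : Measure 𝒵) (Θ : Set (EuclideanSpace ℝ (Fin d)))
    (m : 𝒵 → EuclideanSpace ℝ (Fin d) → ℝ) : Prop where
  concave : ∀ z, ConcaveOn ℝ Θ (m z)
  sq_integrable : ∀ θ ∈ Θ, MemLp (fun z => m z θ) 2 P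

/-- `θ₀` is the unique maximizer over `Θ` of `M(θ) = E m(Z, θ)`, and it is interior to `Θ`. -/
structure IsTrueParameter (P : Measure 𝒵) (Θ : Set (EuclideanSpace ℝ (Fin d)))
    (m : 𝒵 → EuclideanSpace ℝ (Fin d) → ℝ) (θ₀ : EuclideanSpace ℝ (Fin d)) : Prop where
  mem_interior : θ₀ ∈ interior Θ
  unique_max : ∀ θ ∈ Θ, θ ≠ θ₀ → popTarget P m θ < popTarget P m θ₀

/-- `m(z, ·)` is twice differentiable, its Hessian has square integrable entries which are
Lipschitz in `θ` with a square integrable constant, and `-E m̈(Z, θ)` is positive definite. -/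
structure HessianRegular (P : Measure 𝒵) (Θ : Set (EuclideanSpace ℝ (Fin d)))
    (m : 𝒵 → EuclideanSpace ℝ (Fin d) → ℝ) : Prop where
  differentiable : ∀ z, DifferentiableOn ℝ (m z) Θ
  differentiable_grad : ∀ z, DifferentiableOn ℝ (gradientWithin (m z) Θ) Θ
  sq_integrable : ∀ θ ∈ Θ, ∀ k l, MemLp (fun z => hessian Θ (m z) θ k l) 2 P
  posDef : ∀ θ ∈ Θ, (-expectedHessian P Θ m θ).PosDef
  lipschitz : ∃ ψ : 𝒵 → ℝ, MemLp ψ 2 P ∧ ∀ z, ∀ θ₁ ∈ Θ, ∀ θ₂ ∈ Θ, ∀ k l,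
    |hessian Θ (m z) θ₁ k l - hessian Θ (m z) θ₂ k l| ≤ ψ z * ‖θ₁ - θ₂‖

/-- `Λ(θ) = E {ṁ(Z, θ) ṁ(Z, θ)ᵀ}` exists and is positive definite. -/
structure ScoreRegular (P : Measure 𝒵) (Θ : Set (EuclideanSpace ℝ (Fin d)))
    (m : 𝒵 → EuclideanSpace ℝ (Fin d) → ℝ) : Prop where
  sq_integrable : ∀ θ ∈ Θ, ∀ k, MemLp (fun z => gradientWithin (m z) Θ θ k) 2 P
  posDef : ∀ θ ∈ Θ, (scoreCov P Θ m θ).PosDef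

end Population

section Sample

variable {𝒵 : Type*} {d n : ℕ}

/-- The full data target `M_n(θ) = n⁻¹ ∑ m(Z_i, θ)`. -/
def fullTarget (m : 𝒵 → EuclideanSpace ℝ (Fin d) → ℝ) (D : Fin n → 𝒵)
    (θ : EuclideanSpace ℝ (Fin d)) : ℝ :=
  (1 / (n : ℝ)) * ∑ i, m (D i) θ

/-- `n⁻¹ ∑ ‖ṁ(Z_i, θ)‖⁴`. -/
def scoreFourth (Θ : Set (EuclideanSpace ℝ (Fin d))) (m : 𝒵 → EuclideanSpace ℝ (Fin d) → ℝ)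
    (D : Fin n → 𝒵) (θ : EuclideanSpace ℝ (Fin d)) : ℝ :=
  (1 / (n : ℝ)) * ∑ i, ‖gradientWithin (m (D i)) Θ θ‖ ^ 4

/-- `Λ_{n,R}(θ) = n⁻² ∑ ṁ(Z_i, θ) ṁ(Z_i, θ)ᵀ / π_{n,i}`. -/
def lambdaR (Θ : Set (EuclideanSpace ℝ (Fin d))) (m : 𝒵 → EuclideanSpace ℝ (Fin d) → ℝ)
    (p : Fin n → ℝ) (D : Fin n → 𝒵) (θ : EuclideanSpace ℝ (Fin d)) :
    Matrix (Fin d) (Fin d) ℝ :=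
  (1 / (n : ℝ) ^ 2) • ∑ i, (1 / p i) • outer (gradientWithin (m (D i)) Θ θ)

/-- The indices selected by Poisson subsampling: `i` is selected when `u_i ≤ s π_i`. -/
def poissonSample (s : ℝ) (p u : Fin n → ℝ) : Finset (Fin n) :=
  Finset.univ.filter fun i => u i ≤ s * p i

/-- The Poisson subsample target `∑ m(Z_i, θ) / (n s* π_i)`, summed over the subsample, where
`s*` is the (random) size of the subsample. -/
def poissonTarget (m : 𝒵 → EuclideanSpace ℝ (Fin d) → ℝ) (s : ℝ) (p u : Fin n → ℝ)
    (D : Fin n → 𝒵) (θ : EuclideanSpace ℝ (Fin d)) : ℝ :=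
  ∑ i ∈ poissonSample s p u,
    m (D i) θ / ((n : ℝ) * ((poissonSample s p u).card : ℝ) * p i)

/-- `θ` is a maximizer of `f` over the parameter set `Θ`. -/
def IsArgmax (Θ : Set (EuclideanSpace ℝ (Fin d))) (f : EuclideanSpace ℝ (Fin d) → ℝ)
    (θ : EuclideanSpace ℝ (Fin d)) : Prop :=
  θ ∈ Θ ∧ IsMaxOn f Θ θ

end Sample

section Scheme

variable {𝒵 Ω : Type*} [MeasurableSpace 𝒵] [MeasurableSpace Ω]

/-- The full data `D_n = (Z_1, …, Z_n)`, indexed from `0`. -/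
def data (Z : ℕ → Ω → 𝒵) (n : ℕ) (ω : Ω) : Fin n → 𝒵 := fun i => Z i ω

/-- Subsampling distributions for Poisson subsampling: positive probabilities computed measurably
from the full data, with sum one and with `s_n π_{n,i} ≤ 1`. -/
structure IsPoissonDistribution (s : ℕ → ℝ) (p : (n : ℕ) → (Fin n → 𝒵) → Fin n → ℝ) : Prop where
  measurable : ∀ n i, Measurable fun D => p n D i
  pos : ∀ n D i, 0 < p n D i
  sum_eq_one : ∀ n, 1 ≤ n → ∀ D, ∑ i, p n D i = 1
  le_one : ∀ n D i, s n * p n D i ≤ 1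

/-- `Z_1, Z_2, …` are i.i.d. with law `P`, and for each `n` the numbers `u_{n,1}, …, u_{n,n}` are
i.i.d. uniform on `(0,1)` and independent of the full data `(Z_1, …, Z_n)`. -/
structure IsSamplingScheme (μ : Measure Ω) (P : Measure 𝒵) (Z : ℕ → Ω → 𝒵)
    (U : (n : ℕ) → Fin n → Ω → ℝ) : Prop where
  law_data : ∀ i, HasLaw (Z i) P μ
  indep_data : iIndepFun Z μ
  law_unif : ∀ n i, HasLaw (U n i) (volume.restrict (Set.Ioo (0 : ℝ) 1)) μ
  indep_unif : ∀ n, iIndepFun (U n) μ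
  indep : ∀ n, IndepFun (data Z n) (fun ω i => U n i ω) μ

end Scheme

end Subsampling

end

noncomputable section

namespace Subsampling

/-! ### Calculus of convergence and boundedness in probability. -/

section InProbability

variable {Ω : Type*} [MeasurableSpace Ω] {μ : Measure Ω}

/-! A positive factor does not move maximizers. Hence, unless the subsample is empty, its random
size `s*` may be replaced by `s_n`, and the estimator maximizes a weighted target with weights
`1{u_i ≤ s_n π_i} / (n s_n π_i)` (`poissonWeight`). Given the data these weights have mean `1/n`.
Since `max (n π_i)⁻¹` is bounded in probability and `s_n → ∞`, weighted averages of square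
integrable functions satisfy a law of large numbers (`IsSamplingScheme.weightedLLN_poisson`).

The estimator is then linearized. The deterministic `norm_argmax_sub_le` says that the maximizer of
a concave weighted sum whose score `g` at `θ₀` is small, and whose Hessian at `θ₀` is close to a
negative definite `A`, lies within a multiple of `‖g‖` of `θ₀` and satisfies `g + A (θ - θ₀) ≈ 0`.
Concavity is what makes control near `θ₀` suffice. `WeightedLLN.linearization` feeds the law of
large numbers into this, with `A = M̈(θ₀)`. The same argument with weights `1/n` gives consistency
of the full data estimator, which turns the fourth moment condition near `θhat` into one at `θ₀`.

It remains to find the limit law of `√s_n g`. In a direction `u`, put `x = ⟨u, ṁ(·, θ₀)⟩`, `v = uᵀ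
Λπ u` and `σ = E x²`. Then `√s_n ⟨u, g⟩` is the full data average of the `x(Z_i)`, scaled by `√s_n`,
plus a sum of independent centred terms given the data. The conditional characteristic function of
the second part is a product of Bernoulli ones; under a Lyapunov condition it is close to
`exp(-V_n/2)`, where the conditional variance `V_n` is close to `v - (s_n/n) σ`
(`IsSamplingScheme.tendsto_integral_exp_sub`). The first part has characteristic function close to
`exp(-(s_n/n) σ/2)` (`IsSamplingScheme.tendsto_integral_exp_average`). The ratio `s_n/n` need not
converge, but it cancels in the product, leaving `exp(-v/2)`. Slutsky's theorem concludes. -/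

lemma tendstoInMeasure_zero_iff {X : ℕ → Ω → ℝ} :
    TendstoInMeasure μ X atTop (fun _ => 0) ↔
      ∀ ε, 0 < ε → Tendsto (fun n => μ {ω | ε ≤ |X n ω|}) atTop (𝓝 0) := by
  simp [tendstoInMeasure_iff_norm]

lemma tendstoInMeasure_zero_of_abs_le {X Y : ℕ → Ω → ℝ}
    (hY : TendstoInMeasure μ Y atTop (fun _ => 0))
    (h : ∀ᶠ n in atTop, ∀ ω, |X n ω| ≤ |Y n ω|) :
    TendstoInMeasure μ X atTop (fun _ => 0) := by
  rw [tendstoInMeasure_zero_iff] at *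
  intro ε hε
  refine tendsto_of_tendsto_of_tendsto_of_le_of_le' tendsto_const_nhds (hY ε hε)
    (Eventually.of_forall fun _ => zero_le) ?_
  filter_upwards [h] with n hn
  exact measure_mono fun ω hω => le_trans hω (hn ω)

lemma tendstoInMeasure_zero_add {X Y : ℕ → Ω → ℝ}
    (hX : TendstoInMeasure μ X atTop (fun _ => 0))
    (hY : TendstoInMeasure μ Y atTop (fun _ => 0)) :
    TendstoInMeasure μ (fun n ω => X n ω + Y n ω) atTop (fun _ => 0) := by
  rw [tendstoInMeasure_zero_iff] at *
  intro ε hε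
  have := (hX (ε / 2) (half_pos hε)).add (hY (ε / 2) (half_pos hε))
  rw [add_zero] at this
  refine tendsto_of_tendsto_of_tendsto_of_le_of_le tendsto_const_nhds this
    (fun _ => zero_le) fun n => le_trans (measure_mono ?_) (measure_union_le _ _)
  intro ω hω
  simp only [Set.mem_ofPred_eq, Set.mem_union] at *
  by_contra! hc
  have := abs_add_le (X n ω) (Y n ω)
  linarith [hc.1, hc.2]

lemma tendstoInMeasure_sub_const {X : ℕ → Ω → ℝ} {c : ℝ}
    (hX : TendstoInMeasure μ X atTop (fun _ => c)) :
    TendstoInMeasure μ (fun n ω => X n ω - c) atTop (fun _ => 0) := by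
  rw [tendstoInMeasure_iff_norm] at *
  simpa using hX

lemma tendstoInMeasure_zero_const_mul {X : ℕ → Ω → ℝ}
    (hX : TendstoInMeasure μ X atTop (fun _ => 0)) (c : ℝ) :
    TendstoInMeasure μ (fun n ω => c * X n ω) atTop (fun _ => 0) := by
  rw [tendstoInMeasure_zero_iff] at *
  intro ε hε
  refine tendsto_of_tendsto_of_tendsto_of_le_of_le tendsto_const_nhds
    (hX (ε / (|c| + 1)) (by positivity)) (fun _ => zero_le) fun n => measure_mono fun ω hω => ?_
  simp only [Set.mem_ofPred_eq, abs_mul] at *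
  rw [div_le_iff₀ (by positivity)]
  nlinarith [abs_nonneg (X n ω)]

lemma tendstoInMeasure_zero_sum {ι : Type*} (s : Finset ι) {X : ι → ℕ → Ω → ℝ}
    (hX : ∀ i ∈ s, TendstoInMeasure μ (X i) atTop (fun _ => 0)) :
    TendstoInMeasure μ (fun n ω => ∑ i ∈ s, X i n ω) atTop (fun _ => 0) := by
  classical
  induction s using Finset.induction_on with
  | empty =>
    simp only [Finset.sum_empty]
    rw [tendstoInMeasure_zero_iff]
    intro ε hε
    simp [not_le.mpr hε]
  | insert a s ha ih =>
    simp only [Finset.sum_insert ha]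
    exact tendstoInMeasure_zero_add (hX a (by simp))
      (ih fun i hi => hX i (Finset.mem_insert_of_mem hi))

/-- Convergence in probability to a constant, in terms of events of probability tending to `0`. -/
lemma eventually_measure_le_of_tendstoInMeasure {X : ℕ → Ω → ℝ} {c : ℝ}
    (hX : TendstoInMeasure μ X atTop (fun _ => c)) {δ ε : ℝ} (hδ : 0 < δ) (hε : 0 < ε) :
    ∀ᶠ n in atTop, μ {ω | δ ≤ |X n ω - c|} ≤ ENNReal.ofReal ε := by
  rw [tendstoInMeasure_iff_norm] at hX
  have := hX δ hδ
  simp only [Real.norm_eq_abs] at this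
  exact this.eventually (ge_mem_nhds (by simpa using hε))

lemma BoundedInProb.of_tendstoInMeasure {X : ℕ → Ω → ℝ} {c : ℝ}
    (hX : TendstoInMeasure μ X atTop (fun _ => c)) : BoundedInProb μ X := by
  intro ε hε
  refine ⟨|c| + 1, ?_⟩
  filter_upwards [eventually_measure_le_of_tendstoInMeasure hX one_pos hε] with n hn
  refine le_trans (measure_mono fun ω hω => ?_) hn
  simp only [Set.mem_ofPred_eq] at *
  linarith [abs_sub_abs_le_abs_sub (X n ω) c]

lemma BoundedInProb.mul {X Y : ℕ → Ω → ℝ} (hX : BoundedInProb μ X) (hY : BoundedInProb μ Y) :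
    BoundedInProb μ (fun n ω => X n ω * Y n ω) := by
  intro ε hε
  obtain ⟨K, hK⟩ := hX (ε / 2) (half_pos hε)
  obtain ⟨L, hL⟩ := hY (ε / 2) (half_pos hε)
  refine ⟨|K| * |L|, ?_⟩
  filter_upwards [hK, hL] with n h1 h2
  calc _ ≤ μ ({ω | K < |X n ω|} ∪ {ω | L < |Y n ω|}) := measure_mono fun ω hω => ?_
    _ ≤ _ := measure_union_le _ _
    _ ≤ _ := add_le_add h1 h2
    _ = _ := by rw [← ENNReal.ofReal_add (by positivity) (by positivity), add_halves]
  simp only [Set.mem_ofPred_eq, Set.mem_union] at *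
  by_contra! hc
  rw [abs_mul] at hω
  exact absurd hω (not_lt.mpr (mul_le_mul (hc.1.trans (le_abs_self _)) (hc.2.trans (le_abs_self _))
    (abs_nonneg _) (abs_nonneg _)))

lemma BoundedInProb.one_add {X : ℕ → Ω → ℝ} (hX : BoundedInProb μ X) :
    BoundedInProb μ (fun n ω => 1 + X n ω) := by
  intro ε hε
  obtain ⟨K, hK⟩ := hX ε hε
  refine ⟨1 + K, ?_⟩
  filter_upwards [hK] with n h1
  refine le_trans (measure_mono fun ω hω => ?_) h1
  simp only [Set.mem_ofPred_eq] at *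
  have := abs_add_le 1 (X n ω)
  rw [abs_one] at this
  linarith

lemma BoundedInProb.mul_tendsto_zero {X : ℕ → Ω → ℝ} (hX : BoundedInProb μ X) {a : ℕ → ℝ}
    (ha : Tendsto a atTop (𝓝 0)) : TendstoInMeasure μ (fun n ω => a n * X n ω) atTop
      (fun _ => 0) := by
  rw [tendstoInMeasure_zero_iff]
  intro δ hδ
  rw [ENNReal.tendsto_nhds_zero]
  intro ε hε
  obtain ⟨e, he, hle⟩ : ∃ e : ℝ, 0 < e ∧ ENNReal.ofReal e ≤ ε := by
    rcases eq_or_ne ε ⊤ with rfl | h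
    · exact ⟨1, one_pos, le_top⟩
    · exact ⟨ε.toReal, ENNReal.toReal_pos hε.ne' h, by simp [h]⟩
  obtain ⟨K, hK⟩ := hX e he
  have : ∀ᶠ n in atTop, |a n| < δ / (|K| + 1) := by
    have := ha.abs
    rw [abs_zero] at this
    exact this.eventually (gt_mem_nhds (by positivity))
  filter_upwards [hK, this] with n h1 h2
  refine (measure_mono fun ω hω => ?_).trans (h1.trans hle)
  simp only [Set.mem_ofPred_eq, abs_mul] at *
  by_contra! hc
  rw [lt_div_iff₀ (by positivity)] at h2
  have := mul_le_mul_of_nonneg_left (hc.trans (le_abs_self K)) (abs_nonneg (a n))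
  nlinarith [abs_nonneg (a n)]

/-- Bounded convergence in probability. -/
lemma tendsto_integral_zero_of_bounded [IsProbabilityMeasure μ] {F : ℕ → Ω → ℂ} {X : ℕ → Ω → ℝ}
    {C : ℝ} (hX : TendstoInMeasure μ X atTop (fun _ => 0))
    (hC : ∀ᶠ n in atTop, ∀ ω, ‖F n ω‖ ≤ C)
    (h : ∀ᶠ n in atTop, ∀ ω, ‖F n ω‖ ≤ |X n ω|) :
    Tendsto (fun n => ∫ ω, F n ω ∂μ) atTop (𝓝 0) := by
  rw [Metric.tendsto_nhds]
  intro ε hε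
  have hC' : 0 < |C| + 1 := by positivity
  filter_upwards [hC, h, eventually_measure_le_of_tendstoInMeasure hX (half_pos hε)
    (show 0 < ε / 4 / (|C| + 1) by positivity)] with n h1 h2 h3
  rw [dist_zero_right]
  -- A non-measurable integrand has integral `0` by convention.
  by_cases hm : AEStronglyMeasurable (F n) μ
  swap
  · rw [integral_non_aestronglyMeasurable hm]; simpa
  -- `X n` need not be measurable, so the bad event is enlarged to a measurable set of the same
  -- measure.
  set A := toMeasurable μ {ω | ε / 2 ≤ |X n ω - 0|}
  have hA : μ.real A ≤ ε / 4 / (|C| + 1) := by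
    rw [measureReal_def, measure_toMeasurable]
    exact ENNReal.toReal_le_of_le_ofReal (by positivity) h3
  have hAm : MeasurableSet A := measurableSet_toMeasurable _ _
  have hb : ∀ ω, ‖F n ω‖ ≤ ε / 2 + A.indicator (fun _ => |C| + 1) ω := by
    intro ω
    by_cases hω : ω ∈ A
    · rw [Set.indicator_of_mem hω]
      linarith [h1 ω, le_abs_self C]
    · rw [Set.indicator_of_notMem hω]
      have : ω ∉ {ω | ε / 2 ≤ |X n ω - 0|} := fun hh => hω (subset_toMeasurable _ _ hh)
      simp only [sub_zero, Set.mem_ofPred_eq, not_le] at this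
      linarith [h2 ω]
  calc ‖∫ ω, F n ω ∂μ‖ ≤ ∫ ω, (ε / 2 + A.indicator (fun _ => |C| + 1) ω) ∂μ :=
        norm_integral_le_of_norm_le ((integrable_const _).add
          ((integrable_const _).indicator hAm)) (Eventually.of_forall hb)
    _ = ε / 2 + μ.real A * (|C| + 1) := by
        rw [integral_add (integrable_const _) ((integrable_const _).indicator hAm),
          integral_indicator_const _ hAm]
        simp
    _ ≤ ε / 2 + ε / 4 := by
        gcongr
        rwa [← le_div_iff₀ hC']
    _ < ε := by linarith

end InProbability

/-! ### Characteristic functions of centred Bernoulli variables. -/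

section Bernoulli

open Complex

/-- Taylor expansion for `|y| ≤ 1`. For larger `y` the triangle inequality is enough, as `2 + |y| ≤
3 y²`. The next lemma follows the same pattern one order higher. -/
lemma norm_exp_mul_I_sub_le (y : ℝ) : ‖cexp (y * I) - 1 - y * I‖ ≤ 3 * y ^ 2 := by
  rcases le_total |y| 1 with h | h
  · have := Complex.norm_exp_sub_one_sub_id_le (x := y * I) (by simpa using h)
    simp only [norm_mul, norm_real, Real.norm_eq_abs, norm_I, mul_one, sq_abs] at this
    nlinarith [sq_nonneg y]
  · have h1 : ‖cexp (y * I) - 1 - y * I‖ ≤ ‖cexp (y * I)‖ + ‖(1 : ℂ)‖ + ‖(y : ℂ) * I‖ :=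
      (norm_sub_le _ _).trans (by gcongr; exact norm_sub_le _ _)
    rw [norm_exp_ofReal_mul_I] at h1
    simp only [norm_one, norm_mul, norm_real, Real.norm_eq_abs, norm_I, mul_one] at h1
    nlinarith [sq_abs y]

lemma norm_exp_mul_I_sub_sq_le (y : ℝ) :
    ‖cexp (y * I) - 1 - y * I + y ^ 2 / 2‖ ≤ 4 * |y| ^ 3 := by
  rcases le_total |y| 1 with h | h
  · have := Complex.norm_exp_sub_sum_le_norm_mul_exp (y * I) 3
    simp only [Finset.sum_range_succ, Finset.sum_range_zero, zero_add, norm_mul, norm_real,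
      Real.norm_eq_abs, norm_I, mul_one] at this
    have e : cexp (y * I) - 1 - y * I + y ^ 2 / 2 = cexp (y * I) -
        ((y * I) ^ 0 / (Nat.factorial 0 : ℕ) + (y * I) ^ 1 / (Nat.factorial 1 : ℕ) +
          (y * I) ^ 2 / (Nat.factorial 2 : ℕ)) := by
      simp only [mul_pow, I_sq]
      norm_num [Nat.factorial]
      ring
    rw [e]
    refine this.trans ?_
    have h3 : Real.exp |y| ≤ 4 := by
      refine (Real.exp_le_exp.mpr h).trans ?_
      linarith [Real.exp_one_lt_d9]
    rw [mul_comm]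
    gcongr
  · have h1 : ‖cexp (y * I) - 1 - y * I + y ^ 2 / 2‖ ≤
        ‖cexp (y * I)‖ + ‖(1 : ℂ)‖ + ‖(y : ℂ) * I‖ + ‖(y : ℂ) ^ 2 / 2‖ :=
      (norm_add_le _ _).trans
        (add_le_add_left ((norm_sub_le _ _).trans (add_le_add_left (norm_sub_le _ _) _)) _)
    rw [norm_exp_ofReal_mul_I] at h1
    simp only [norm_one, norm_mul, norm_real, Real.norm_eq_abs, norm_I, mul_one, norm_div,
      norm_pow, RCLike.norm_ofNat] at h1
    have h2 : |y| ≤ |y| ^ 3 := le_self_pow₀ h (by norm_num)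
    have h4 : |y| ^ 2 ≤ |y| ^ 3 := pow_le_pow_right₀ h (by norm_num)
    linarith

/-- The characteristic function at `c` of `B / q - 1`, where `B` is Bernoulli with parameter `q`. -/
def bernoulliCharFun (q c : ℝ) : ℂ :=
  q * cexp ((c * (1 / q - 1) : ℝ) * I) + (1 - q) * cexp ((-c : ℝ) * I)

variable {q : ℝ}

lemma norm_bernoulliCharFun_le (h0 : 0 < q) (h1 : q ≤ 1) (c : ℝ) :
    ‖bernoulliCharFun q c‖ ≤ 1 := by
  refine (norm_add_le _ _).trans ?_
  rw [norm_mul, norm_mul, norm_exp_ofReal_mul_I, norm_exp_ofReal_mul_I]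
  have : ‖(1 - q : ℂ)‖ = 1 - q := by
    rw [← ofReal_one, ← ofReal_sub, norm_real, Real.norm_of_nonneg (by linarith)]
  rw [this, norm_real, Real.norm_of_nonneg h0.le]
  linarith

/-- The variable is centred, so the linear terms of the two exponentials cancel and only its
variance `c² (1/q - 1)` counts. -/
lemma norm_bernoulliCharFun_sub_one_le (h0 : 0 < q) (h1 : q ≤ 1) (c : ℝ) :
    ‖bernoulliCharFun q c - 1‖ ≤ 3 * (c ^ 2 / q) := by
  have hq : (q : ℂ) ≠ 0 := by exact_mod_cast h0.ne'
  have e : bernoulliCharFun q c - 1 =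
      (q : ℝ) * (cexp ((c * (1 / q - 1) : ℝ) * I) - 1 - (c * (1 / q - 1) : ℝ) * I) +
      (1 - q : ℝ) * (cexp ((-c : ℝ) * I) - 1 - (-c : ℝ) * I) := by
    simp only [bernoulliCharFun]
    push_cast
    field_simp
    ring
  rw [e]
  refine (norm_add_le _ _).trans ?_
  rw [norm_mul, norm_mul, norm_real, norm_real, Real.norm_of_nonneg h0.le,
    Real.norm_of_nonneg (by linarith : 0 ≤ 1 - q)]
  calc _ ≤ q * (3 * (c * (1 / q - 1)) ^ 2) + (1 - q) * (3 * (-c) ^ 2) := by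
        gcongr ?_ * ?_ + (1 - q) * ?_
        · exact norm_exp_mul_I_sub_le _
        · exact norm_exp_mul_I_sub_le _
    _ = 3 * (c ^ 2 / q) - 3 * c ^ 2 := by field_simp; ring
    _ ≤ _ := by nlinarith [sq_nonneg c]

/-- Both terms agree to second order, with variance `2v = c² (1/q - 1)`. The third absolute moment
of the Bernoulli variable produces `|c|³/q²`, and the remainder of the real exponential, at most
`v²`, produces `c⁴/q²`. -/
lemma norm_bernoulliCharFun_sub_exp_le (h0 : 0 < q) (h1 : q ≤ 1) (c : ℝ) :
    ‖bernoulliCharFun q c - (Real.exp (-(c ^ 2 * (1 / q - 1) / 2)) : ℝ)‖ ≤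
      8 * (|c| ^ 3 / q ^ 2) + c ^ 4 / q ^ 2 := by
  have hq : (q : ℂ) ≠ 0 := by exact_mod_cast h0.ne'
  have hq1 : 0 ≤ 1 / q - 1 := by
    rw [sub_nonneg, le_div_iff₀ h0]; linarith
  set v : ℝ := c ^ 2 * (1 / q - 1) / 2 with hv
  have hv0 : 0 ≤ v := by positivity
  have e : bernoulliCharFun q c - (Real.exp (-v) : ℝ) =
      ((q : ℝ) * (cexp ((c * (1 / q - 1) : ℝ) * I) - 1 - (c * (1 / q - 1) : ℝ) * I
        + (c * (1 / q - 1) : ℝ) ^ 2 / 2) +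
      (1 - q : ℝ) * (cexp ((-c : ℝ) * I) - 1 - (-c : ℝ) * I + (-c : ℝ) ^ 2 / 2)) -
      (Real.exp (-v) - 1 + v : ℝ) := by
    rw [hv]
    simp only [bernoulliCharFun]
    push_cast
    field_simp
    ring
  rw [e]
  have hexp : ‖((Real.exp (-v) - 1 + v : ℝ) : ℂ)‖ ≤ c ^ 4 / q ^ 2 := by
    rw [norm_real, Real.norm_eq_abs]
    have hb : |Real.exp (-v) - 1 + v| ≤ v ^ 2 := by
      rcases le_total v 1 with h | h
      · have := Real.abs_exp_sub_one_sub_id_le (x := -v) (by rwa [abs_neg, abs_of_nonneg hv0])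
        simpa using this
      · rw [abs_of_nonneg (by linarith [Real.add_one_le_exp (-v)])]
        have : Real.exp (-v) ≤ 1 := Real.exp_le_one_iff.mpr (by linarith)
        nlinarith
    refine hb.trans ?_
    have : v ≤ c ^ 2 / q := by
      rw [hv, div_eq_mul_one_div (c ^ 2) q]
      nlinarith [mul_nonneg (sq_nonneg c) hq1, sq_nonneg c]
    calc v ^ 2 ≤ (c ^ 2 / q) ^ 2 := by gcongr
      _ = _ := by ring
  have h3 : ‖((q : ℝ) * (cexp ((c * (1 / q - 1) : ℝ) * I) - 1 - (c * (1 / q - 1) : ℝ) * I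
        + (c * (1 / q - 1) : ℝ) ^ 2 / 2) +
      (1 - q : ℝ) * (cexp ((-c : ℝ) * I) - 1 - (-c : ℝ) * I + (-c : ℝ) ^ 2 / 2) : ℂ)‖ ≤
      8 * (|c| ^ 3 / q ^ 2) := by
    refine (norm_add_le _ _).trans ?_
    rw [norm_mul, norm_mul, norm_real, norm_real, Real.norm_of_nonneg h0.le,
      Real.norm_of_nonneg (by linarith : 0 ≤ 1 - q)]
    have hc3 : 0 ≤ |c| ^ 3 := by positivity
    have ha : |c * (1 / q - 1)| ^ 3 ≤ |c| ^ 3 / q ^ 3 := by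
      rw [abs_mul, mul_pow, abs_of_nonneg hq1, div_eq_mul_one_div (|c| ^ 3), ← one_div_pow]
      gcongr
      linarith
    calc _ ≤ q * (4 * |c * (1 / q - 1)| ^ 3) + (1 - q) * (4 * |-c| ^ 3) := by
          gcongr ?_ * ?_ + (1 - q) * ?_
          · exact norm_exp_mul_I_sub_sq_le _
          · exact norm_exp_mul_I_sub_sq_le _
      _ ≤ q * (4 * (|c| ^ 3 / q ^ 3)) + 1 * (4 * |c| ^ 3) := by
          rw [abs_neg]
          gcongr
          linarith
      _ = 4 * (|c| ^ 3 / q ^ 2) + 4 * |c| ^ 3 := by field_simp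
      _ ≤ _ := by
          have : |c| ^ 3 ≤ |c| ^ 3 / q ^ 2 := by
            rw [le_div_iff₀ (by positivity)]
            nlinarith [pow_le_one₀ h0.le h1 (n := 2)]
          linarith
  exact (norm_sub_le _ _).trans (add_le_add h3 hexp)

/-- Telescoping: factors are exchanged one at a time, and the others have norm at most one. -/
lemma norm_prod_sub_prod_le {ι : Type*} (s : Finset ι) (z w : ι → ℂ) (hz : ∀ i ∈ s, ‖z i‖ ≤ 1)
    (hw : ∀ i ∈ s, ‖w i‖ ≤ 1) : ‖∏ i ∈ s, z i - ∏ i ∈ s, w i‖ ≤ ∑ i ∈ s, ‖z i - w i‖ := by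
  classical
  induction s using Finset.induction_on with
  | empty => simp
  | insert a s ha ih =>
    rw [Finset.prod_insert ha, Finset.prod_insert ha, Finset.sum_insert ha]
    have e : z a * ∏ i ∈ s, z i - w a * ∏ i ∈ s, w i =
        (z a - w a) * ∏ i ∈ s, z i + w a * (∏ i ∈ s, z i - ∏ i ∈ s, w i) := by ring
    rw [e]
    refine (norm_add_le _ _).trans ?_
    rw [norm_mul, norm_mul]
    have h1 : ‖∏ i ∈ s, z i‖ ≤ 1 := by
      rw [norm_prod]
      exact Finset.prod_le_one (fun _ _ => norm_nonneg _)
        fun i hi => hz i (Finset.mem_insert_of_mem hi)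
    have h2 := ih (fun i hi => hz i (Finset.mem_insert_of_mem hi))
      (fun i hi => hw i (Finset.mem_insert_of_mem hi))
    have h3 := hw a (Finset.mem_insert_self _ _)
    gcongr
    · exact mul_le_of_le_one_right (norm_nonneg _) h1
    · exact (mul_le_of_le_one_left (norm_nonneg _) h3).trans h2

/-- `B / q - 1`, where `B` is the indicator of `u ≤ q`. -/
def centeredInclusion (q u : ℝ) : ℝ := (if u ≤ q then 1 / q else 0) - 1

lemma measurable_centeredInclusion : Measurable fun x : ℝ × ℝ => centeredInclusion x.1 x.2 := by
  unfold centeredInclusion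
  refine Measurable.sub_const (Measurable.ite ?_ (by fun_prop) (by fun_prop)) _
  exact measurableSet_le measurable_snd measurable_fst

instance : IsProbabilityMeasure (volume.restrict (Set.Ioo (0 : ℝ) 1)) :=
  ⟨by simp⟩

lemma integral_exp_centeredInclusion (h0 : 0 < q) (h1 : q ≤ 1) (c : ℝ) :
    ∫ u in Set.Ioo (0 : ℝ) 1, cexp ((c * centeredInclusion q u : ℝ) * I) =
      bernoulliCharFun q c := by
  have e : ∀ u, cexp ((c * centeredInclusion q u : ℝ) * I) =
      (Set.Iic q).indicator (fun _ => cexp ((c * (1 / q - 1) : ℝ) * I) - cexp ((-c : ℝ) * I)) u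
        + cexp ((-c : ℝ) * I) := by
    intro u
    by_cases hu : u ≤ q
    · rw [Set.indicator_of_mem (by exact hu), centeredInclusion, if_pos hu]; ring
    · rw [Set.indicator_of_notMem (by exact hu), centeredInclusion, if_neg hu]; simp
  simp_rw [e]
  rw [integral_add ((integrable_const _).indicator measurableSet_Iic) (integrable_const _),
    integral_indicator_const _ measurableSet_Iic, integral_const]
  have hv : (volume.restrict (Set.Ioo (0 : ℝ) 1)).real (Set.Iic q) = q := by
    rw [measureReal_restrict_apply measurableSet_Iic]
    -- At `q = 1` the intersection is the open unit interval and not `Ioc 0 q`.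
    rcases h1.eq_or_lt with rfl | h1
    · have : Set.Iic (1 : ℝ) ∩ Set.Ioo 0 1 = Set.Ioo 0 1 := by
        ext; simp; intro _ h; exact h.le
      simp [this]
    · have : Set.Iic q ∩ Set.Ioo 0 1 = Set.Ioc 0 q := by
        ext x; simp; constructor
        · rintro ⟨h, h', -⟩; exact ⟨h', h⟩
        · rintro ⟨h, h'⟩; exact ⟨h', h, h'.trans_lt h1⟩
      simp [this, h0.le]
  rw [hv, probReal_univ, bernoulliCharFun]
  simp only [real_smul, one_smul]
  push_cast
  ring

end Bernoulli

/-! ### Conditional limit theorems for Poisson subsampling. -/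

section Sampling

open Complex

variable {𝒵 Ω : Type*} [MeasurableSpace 𝒵] [MeasurableSpace Ω] {μ : Measure Ω}
  {P : Measure 𝒵} {Z : ℕ → Ω → 𝒵} {U : (n : ℕ) → Fin n → Ω → ℝ}

lemma IsSamplingScheme.aemeasurable_data (h : IsSamplingScheme μ P Z U) (n : ℕ) :
    AEMeasurable (data Z n) μ :=
  aemeasurable_pi_lambda _ fun i => (h.law_data i).aemeasurable

lemma IsSamplingScheme.aemeasurable_unif (h : IsSamplingScheme μ P Z U) (n : ℕ) :
    AEMeasurable (fun ω i => U n i ω) μ :=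
  aemeasurable_pi_lambda _ fun i => (h.law_unif n i).aemeasurable

/-- Scores and Hessians are only a.e. measurable for `P`; this survives composition with a
coordinate because each coordinate of the data has law `P`. -/
lemma IsSamplingScheme.aemeasurable_comp_eval (h : IsSamplingScheme μ P Z U) {n : ℕ}
    (i : Fin n) {E : Type*} [MeasurableSpace E] {f : 𝒵 → E} (hf : AEMeasurable f P) :
    AEMeasurable (fun D : Fin n → 𝒵 => f (D i)) (μ.map (data Z n)) := by
  have hmap : (μ.map (data Z n)).map (fun D => D i) = P := by
    rw [AEMeasurable.map_map_of_aemeasurable (measurable_pi_apply i).aemeasurable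
      (h.aemeasurable_data n)]
    exact (h.law_data i).map_eq
  exact AEMeasurable.comp_aemeasurable (g := f) (by rwa [hmap]) (measurable_pi_apply i).aemeasurable

lemma IsSamplingScheme.map_prod [IsProbabilityMeasure μ] (h : IsSamplingScheme μ P Z U) (n : ℕ) :
    μ.map (fun ω => (data Z n ω, fun i => U n i ω)) = (μ.map (data Z n)).prod
      (Measure.pi fun _ : Fin n => volume.restrict (Set.Ioo (0 : ℝ) 1)) := by
  rw [(indepFun_iff_map_prod_eq_prod_map_map (h.aemeasurable_data n)
    (h.aemeasurable_unif n)).mp (h.indep n),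
    (iIndepFun_iff_map_fun_eq_pi_map fun i => (h.law_unif n i).aemeasurable).mp (h.indep_unif n)]
  congr 2
  ext1 i
  rw [(h.law_unif n i).map_eq]

/-- The conditional characteristic function of a sum over a Poisson subsample, given the data. -/
lemma IsSamplingScheme.integral_exp_eq [IsProbabilityMeasure μ] (h : IsSamplingScheme μ P Z U)
    {n : ℕ} {b : (Fin n → 𝒵) → ℝ} {c q : (Fin n → 𝒵) → Fin n → ℝ}
    (hb : AEMeasurable b (μ.map (data Z n)))
    (hc : ∀ i, AEMeasurable (fun D => c D i) (μ.map (data Z n)))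
    (hq : ∀ i, Measurable fun D => q D i) (hq01 : ∀ D i, 0 < q D i ∧ q D i ≤ 1) :
    ∫ ω, cexp ((b (data Z n ω) + ∑ i, c (data Z n ω) i *
      centeredInclusion (q (data Z n ω) i) (U n i ω) : ℝ) * I) ∂μ =
    ∫ ω, cexp (b (data Z n ω) * I) *
      ∏ i, bernoulliCharFun (q (data Z n ω) i) (c (data Z n ω) i) ∂μ := by
  have := Measure.isProbabilityMeasure_map (h.aemeasurable_data n)
  set Q := μ.map (data Z n) with hQ
  set ν := Measure.pi fun _ : Fin n => volume.restrict (Set.Ioo (0 : ℝ) 1) with hν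
  let G : (Fin n → 𝒵) × (Fin n → ℝ) → ℂ := fun x =>
    cexp ((b x.1 + ∑ i, c x.1 i * centeredInclusion (q x.1 i) (x.2 i) : ℝ) * I)
  have hGr : AEMeasurable (fun x : (Fin n → 𝒵) × (Fin n → ℝ) =>
      b x.1 + ∑ i, c x.1 i * centeredInclusion (q x.1 i) (x.2 i)) (Q.prod ν) := by
    refine AEMeasurable.add (hb.comp_quasiMeasurePreserving
      Measure.quasiMeasurePreserving_fst) ?_
    refine Finset.aemeasurable_fun_sum _ fun i _ => AEMeasurable.mul
      ((hc i).comp_quasiMeasurePreserving Measure.quasiMeasurePreserving_fst) ?_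
    exact (measurable_centeredInclusion.comp (((hq i).comp measurable_fst).prodMk
      ((measurable_pi_apply i).comp measurable_snd))).aemeasurable
  have hGm : AEStronglyMeasurable G (Q.prod ν) := by
    refine AEMeasurable.aestronglyMeasurable ?_
    exact Complex.measurable_exp.comp_aemeasurable
      ((Complex.measurable_ofReal.comp_aemeasurable hGr).mul_const _)
  have hGi : Integrable G (Q.prod ν) :=
    Integrable.of_bound hGm 1 (Eventually.of_forall fun x => by
      simp only [G]; rw [norm_exp_ofReal_mul_I])
  -- With the data frozen, the exponential factors over the coordinates of the product measure;
  -- Fubini then integrates over the data.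
  have hinner : ∀ D, ∫ u, G (D, u) ∂ν =
      cexp (b D * I) * ∏ i, bernoulliCharFun (q D i) (c D i) := by
    intro D
    have e : ∀ u : Fin n → ℝ, G (D, u) = cexp (b D * I) *
        ∏ i, cexp ((c D i * centeredInclusion (q D i) (u i) : ℝ) * I) := by
      intro u
      simp only [G]
      rw [← Complex.exp_sum, ← Complex.exp_add, ← Finset.sum_mul]
      push_cast
      rw [add_mul]
    simp_rw [e]
    rw [integral_const_mul, hν, integral_fintype_prod_eq_prod
      (f := fun i u => cexp ((c D i * centeredInclusion (q D i) u : ℝ) * I))]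
    congr 1
    exact Finset.prod_congr rfl fun i _ =>
      integral_exp_centeredInclusion (hq01 D i).1 (hq01 D i).2 _
  have hpair : AEMeasurable (fun ω => (data Z n ω, fun i => U n i ω)) μ :=
    (h.aemeasurable_data n).prodMk (h.aemeasurable_unif n)
  calc _ = ∫ ω, G (data Z n ω, fun i => U n i ω) ∂μ := rfl
    _ = ∫ x, G x ∂(Q.prod ν) := by
        rw [← h.map_prod n, integral_map hpair]
        rw [h.map_prod n]
        exact hGm
    _ = ∫ D, ∫ u, G (D, u) ∂ν ∂Q := integral_prod _ hGi
    _ = ∫ ω, (∫ u, G (data Z n ω, u) ∂ν) ∂μ := by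
        rw [hQ, integral_map (h.aemeasurable_data n)]
        exact hGi.integral_prod_left.aestronglyMeasurable
    _ = _ := by simp_rw [hinner]

lemma measurable_bernoulliCharFun : Measurable fun x : ℝ × ℝ => bernoulliCharFun x.1 x.2 := by
  unfold bernoulliCharFun
  fun_prop

/-- A sum over a Poisson subsample, minus its conditional expectation given the data. -/
def inclusionSum (Z : ℕ → Ω → 𝒵) (U : (n : ℕ) → Fin n → Ω → ℝ)
    (c q : (n : ℕ) → (Fin n → 𝒵) → Fin n → ℝ) (n : ℕ) (ω : Ω) : ℝ :=
  ∑ i, c n (data Z n ω) i * centeredInclusion (q n (data Z n ω) i) (U n i ω)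

variable {c q : (n : ℕ) → (Fin n → 𝒵) → Fin n → ℝ}

lemma IsSamplingScheme.aemeasurable_inclusionSum (h : IsSamplingScheme μ P Z U)
    (hc : ∀ n i, AEMeasurable (fun D => c n D i) (μ.map (data Z n)))
    (hq : ∀ n i, Measurable fun D => q n D i) (n : ℕ) :
    AEMeasurable (inclusionSum Z U c q n) μ := by
  refine Finset.aemeasurable_fun_sum _ fun i _ => AEMeasurable.mul
    ((hc n i).comp_aemeasurable (h.aemeasurable_data n)) ?_
  exact measurable_centeredInclusion.comp_aemeasurable
    (((hq n i).comp_aemeasurable (h.aemeasurable_data n)).prodMk (h.law_unif n i).aemeasurable)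

/-- Weak convergence controls the probabilities of closed sets. -/
lemma eventually_measure_closed_le [IsProbabilityMeasure μ] {E Ω' : Type*} [MeasurableSpace Ω']
    {μ' : Measure Ω'} [IsProbabilityMeasure μ'] [PseudoEMetricSpace E] [MeasurableSpace E]
    [BorelSpace E] {X : ℕ → Ω → E} {X' : Ω' → E}
    (hX : TendstoInDistribution X atTop X' (fun _ => μ) μ') {F : Set E} (hF : IsClosed F)
    {ε : ENNReal} (hε : μ' (X' ⁻¹' F) < ε) : ∀ᶠ n in atTop, μ (X n ⁻¹' F) ≤ ε := by
  have h1 := ProbabilityMeasure.limsup_measure_closed_le_of_tendsto hX.tendsto hF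
  simp only [ProbabilityMeasure.coe_mk] at h1
  rw [Measure.map_apply_of_aemeasurable hX.aemeasurable_limit hF.measurableSet] at h1
  have h2 := eventually_lt_of_limsup_lt (h1.trans_lt hε)
  filter_upwards [h2] with n hn
  rw [Measure.map_apply_of_aemeasurable (hX.forall_aemeasurable n) hF.measurableSet] at hn
  exact hn.le

/-- Lévy's continuity theorem gives convergence in law to the point mass at `0`, which does not
charge the closed sets `{ε ≤ |x|}`. -/
lemma tendstoInMeasure_zero_of_charFun [IsProbabilityMeasure μ] {X : ℕ → Ω → ℝ}
    (hm : ∀ n, AEMeasurable (X n) μ)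
    (h : ∀ t : ℝ, Tendsto (fun n => ∫ ω, cexp ((t * X n ω : ℝ) * I) ∂μ) atTop (𝓝 1)) :
    TendstoInMeasure μ X atTop (fun _ => 0) := by
  have hd : TendstoInDistribution X atTop (fun _ : Ω => (0 : ℝ)) (fun _ => μ) μ := by
    refine ⟨hm, aemeasurable_const, ProbabilityMeasure.tendsto_iff_tendsto_charFun.mpr fun t => ?_⟩
    simp only [ProbabilityMeasure.coe_mk]
    have e : ∀ n, charFun (μ.map (X n)) t = ∫ ω, cexp ((t * X n ω : ℝ) * I) ∂μ := by
      intro n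
      rw [charFun_apply_real, integral_map (hm n) (by fun_prop)]
      simp
    simp_rw [e]
    simpa [charFun_apply_real] using h t
  rw [tendstoInMeasure_zero_iff]
  intro ε hε
  rw [ENNReal.tendsto_nhds_zero]
  intro δ hδ
  have hcl : IsClosed {x : ℝ | ε ≤ |x|} := isClosed_le continuous_const continuous_abs
  exact eventually_measure_closed_le hd hcl (by simpa [Set.preimage, not_le.mpr hε] using hδ)

/-- A weak law of large numbers for Poisson subsampling. -/
lemma IsSamplingScheme.tendstoInMeasure_inclusionSum [IsProbabilityMeasure μ]
    (h : IsSamplingScheme μ P Z U)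
    (hc : ∀ n i, AEMeasurable (fun D => c n D i) (μ.map (data Z n)))
    (hq : ∀ n i, Measurable fun D => q n D i)
    (hq01 : ∀ᶠ n in atTop, ∀ D i, 0 < q n D i ∧ q n D i ≤ 1)
    (hv : TendstoInMeasure μ
      (fun n ω => ∑ i, c n (data Z n ω) i ^ 2 / q n (data Z n ω) i) atTop (fun _ => 0)) :
    TendstoInMeasure μ (inclusionSum Z U c q) atTop (fun _ => 0) := by
  refine tendstoInMeasure_zero_of_charFun (h.aemeasurable_inclusionSum hc hq) fun t => ?_
  -- Replacing the Bernoulli factors by `1` costs at most `3 t² ∑ c_i²/q_i`, which vanishes in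
  -- probability, and never more than `2`. No moments of the sum are needed.
  have key : Tendsto (fun n => ∫ ω, ((∏ i, bernoulliCharFun (q n (data Z n ω) i)
      (t * c n (data Z n ω) i)) - 1) ∂μ) atTop (𝓝 0) := by
    refine tendsto_integral_zero_of_bounded (C := 2)
      (tendstoInMeasure_zero_const_mul hv (3 * t ^ 2)) ?_ ?_
    · filter_upwards [hq01] with n hn ω
      refine (norm_sub_le _ _).trans ?_
      rw [norm_prod, norm_one]
      have := Finset.prod_le_one (s := Finset.univ)
        (f := fun i => ‖bernoulliCharFun (q n (data Z n ω) i) (t * c n (data Z n ω) i)‖)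
        (fun _ _ => norm_nonneg _)
        fun i _ => norm_bernoulliCharFun_le (hn _ i).1 (hn _ i).2 _
      linarith
    · filter_upwards [hq01] with n hn ω
      have := norm_prod_sub_prod_le Finset.univ
        (fun i => bernoulliCharFun (q n (data Z n ω) i) (t * c n (data Z n ω) i)) (fun _ => 1)
        (fun i _ => norm_bernoulliCharFun_le (hn _ i).1 (hn _ i).2 _) (by simp)
      rw [Finset.prod_const_one] at this
      refine this.trans (le_trans ?_ (le_abs_self _))
      rw [Finset.mul_sum]
      refine Finset.sum_le_sum fun i _ => (norm_bernoulliCharFun_sub_one_le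
        (hn _ i).1 (hn _ i).2 _).trans (le_of_eq ?_)
      ring
  have hint : ∀ n, AEStronglyMeasurable (fun ω => ∏ i, bernoulliCharFun (q n (data Z n ω) i)
      (t * c n (data Z n ω) i)) μ := by
    intro n
    refine (Finset.aemeasurable_fun_prod _ fun i _ => ?_).aestronglyMeasurable
    exact measurable_bernoulliCharFun.comp_aemeasurable
      (((hq n i).comp_aemeasurable (h.aemeasurable_data n)).prodMk
        (((hc n i).comp_aemeasurable (h.aemeasurable_data n)).const_mul t))
  have key2 := key.add_const 1
  rw [zero_add] at key2
  refine key2.congr' ?_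
  filter_upwards [hq01] with n hn
  have e := h.integral_exp_eq (n := n) (b := fun _ => 0) (c := fun D i => t * c n D i) (q := q n)
    aemeasurable_const (fun i => (hc n i).const_mul t) (hq n) hn
  have hi : Integrable (fun ω => ∏ i, bernoulliCharFun (q n (data Z n ω) i)
      (t * c n (data Z n ω) i)) μ := by
    refine Integrable.of_bound (hint n) 1 (Eventually.of_forall fun ω => ?_)
    rw [norm_prod]
    exact Finset.prod_le_one (fun _ _ => norm_nonneg _)
        fun i _ => norm_bernoulliCharFun_le (hn _ i).1 (hn _ i).2 _
  rw [integral_sub hi (integrable_const _)]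
  simp only [ofReal_zero, zero_mul, Complex.exp_zero, one_mul, zero_add] at e
  rw [← e]
  simp only [integral_const, probReal_univ, one_smul, sub_add_cancel]
  refine integral_congr_ae (Eventually.of_forall fun ω => ?_)
  simp only [inclusionSum, Finset.mul_sum, mul_assoc]

/-- Under a Lyapunov condition, the conditional characteristic function of a sum over a Poisson
subsample is asymptotically Gaussian. -/
lemma IsSamplingScheme.tendsto_integral_exp_sub [IsProbabilityMeasure μ]
    (h : IsSamplingScheme μ P Z U) {b : (n : ℕ) → (Fin n → 𝒵) → ℝ} {τ : ℕ → ℝ} {C : ℝ}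
    (hb : ∀ n, AEMeasurable (b n) (μ.map (data Z n)))
    (hc : ∀ n i, AEMeasurable (fun D => c n D i) (μ.map (data Z n)))
    (hq : ∀ n i, Measurable fun D => q n D i)
    (hq01 : ∀ᶠ n in atTop, ∀ D i, 0 < q n D i ∧ q n D i ≤ 1)
    (h3 : TendstoInMeasure μ
      (fun n ω => ∑ i, |c n (data Z n ω) i| ^ 3 / q n (data Z n ω) i ^ 2) atTop (fun _ => 0))
    (h4 : TendstoInMeasure μ
      (fun n ω => ∑ i, c n (data Z n ω) i ^ 4 / q n (data Z n ω) i ^ 2) atTop (fun _ => 0))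
    (hτ : ∀ᶠ n in atTop, -C ≤ τ n)
    (hv : TendstoInMeasure μ (fun n ω => ∑ i, c n (data Z n ω) i ^ 2 *
      (1 / q n (data Z n ω) i - 1) - τ n) atTop (fun _ => 0)) :
    Tendsto (fun n => ∫ ω, cexp ((b n (data Z n ω) + inclusionSum Z U c q n ω : ℝ) * I) ∂μ -
      (∫ ω, cexp (b n (data Z n ω) * I) ∂μ) * (Real.exp (-(τ n / 2)) : ℝ)) atTop (𝓝 0) := by
  -- The function `exp(-x/2)` is Lipschitz only on half-lines `[-K, ∞)`, hence the lower bound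
  -- required of `τ`.
  have hlip : ∀ a b K : ℝ, -K ≤ a → -K ≤ b →
      |Real.exp (-(a / 2)) - Real.exp (-(b / 2))| ≤ Real.exp (K / 2) * |a - b| := by
    intro a b K
    wlog hab : a ≤ b generalizing a b
    · intro ha hb
      rw [abs_sub_comm, abs_sub_comm a]
      exact this b a (le_of_not_ge hab) hb ha
    intro ha _
    have e1 : Real.exp (-(b / 2)) = Real.exp (-(a / 2)) * Real.exp (-((b - a) / 2)) := by
      rw [← Real.exp_add]; ring_nf
    have e2 := Real.add_one_le_exp (-((b - a) / 2))
    have e3 : Real.exp (-(a / 2)) ≤ Real.exp (K / 2) := Real.exp_le_exp.mpr (by linarith)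
    have e4 : Real.exp (-(b / 2)) ≤ Real.exp (-(a / 2)) := Real.exp_le_exp.mpr (by linarith)
    rw [abs_of_nonneg (by linarith), abs_of_nonpos (by linarith), e1]
    calc _ = Real.exp (-(a / 2)) * (1 - Real.exp (-((b - a) / 2))) := by ring
      _ ≤ Real.exp (-(a / 2)) * (-(a - b)) := by
        have := Real.exp_pos (-(a / 2))
        gcongr
        linarith
      _ ≤ _ := by
        have : 0 ≤ -(a - b) := by linarith
        gcongr
  have hvar0 : ∀ᶠ n in atTop, ∀ ω, 0 ≤ ∑ i, c n (data Z n ω) i ^ 2 *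
      (1 / q n (data Z n ω) i - 1) := by
    filter_upwards [hq01] with n hn ω
    refine Finset.sum_nonneg fun i _ => mul_nonneg (sq_nonneg _) ?_
    rw [sub_nonneg, le_div_iff₀ (hn _ i).1]
    linarith [(hn (data Z n ω) i).2]
  -- Nonnegativity of `K` makes `-K` a lower bound for the conditional variance as well as for `τ
  -- n`.
  set K := |C| with hK
  have key : Tendsto (fun n => ∫ ω, (cexp (b n (data Z n ω) * I) *
      (∏ i, bernoulliCharFun (q n (data Z n ω) i) (c n (data Z n ω) i) -
        (Real.exp (-(τ n / 2)) : ℝ))) ∂μ) atTop (𝓝 0) := by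
    have hbound := tendstoInMeasure_zero_add (tendstoInMeasure_zero_add
      (tendstoInMeasure_zero_const_mul h3 8) h4)
      (tendstoInMeasure_zero_const_mul (tendstoInMeasure_zero_of_abs_le
        (X := fun n ω => |∑ i, c n (data Z n ω) i ^ 2 * (1 / q n (data Z n ω) i - 1) - τ n|) hv
        (Eventually.of_forall fun n ω => (abs_abs _).le)) (Real.exp (K / 2)))
    refine tendsto_integral_zero_of_bounded (C := 1 + Real.exp (K / 2)) hbound ?_ ?_
    · filter_upwards [hq01, hτ] with n hn hτn ω
      rw [norm_mul, norm_exp_ofReal_mul_I, one_mul]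
      refine (norm_sub_le _ _).trans (add_le_add ?_ ?_)
      · rw [norm_prod]
        exact Finset.prod_le_one (fun _ _ => norm_nonneg _)
          fun i _ => norm_bernoulliCharFun_le (hn _ i).1 (hn _ i).2 _
      · rw [norm_real, Real.norm_of_nonneg (Real.exp_pos _).le]
        exact Real.exp_le_exp.mpr (by linarith [le_abs_self C])
    · filter_upwards [hq01, hτ, hvar0] with n hn hτn hv0 ω
      rw [norm_mul, norm_exp_ofReal_mul_I, one_mul]
      refine le_trans ?_ (le_abs_self _)
      set v : ℝ := ∑ i, c n (data Z n ω) i ^ 2 * (1 / q n (data Z n ω) i - 1)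
      have hprod : ((Real.exp (-(v / 2)) : ℝ) : ℂ) = ∏ i, ((Real.exp (-(c n (data Z n ω) i ^ 2 *
          (1 / q n (data Z n ω) i - 1) / 2)) : ℝ) : ℂ) := by
        rw [← ofReal_prod, ← Real.exp_sum, Finset.sum_neg_distrib, ← Finset.sum_div]
      have h1 := norm_prod_sub_prod_le Finset.univ
        (fun i => bernoulliCharFun (q n (data Z n ω) i) (c n (data Z n ω) i))
        (fun i => ((Real.exp (-(c n (data Z n ω) i ^ 2 *
          (1 / q n (data Z n ω) i - 1) / 2)) : ℝ) : ℂ))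
        (fun i _ => norm_bernoulliCharFun_le (hn _ i).1 (hn _ i).2 _) (fun i _ => by
          rw [norm_real, Real.norm_of_nonneg (Real.exp_pos _).le]
          refine Real.exp_le_one_iff.mpr (neg_nonpos.mpr (div_nonneg (mul_nonneg (sq_nonneg _) ?_)
            zero_le_two))
          rw [sub_nonneg, le_div_iff₀ (hn _ i).1]
          linarith [(hn (data Z n ω) i).2])
      rw [← hprod] at h1
      have h2 := Finset.sum_le_sum fun i (_ : i ∈ Finset.univ) => norm_bernoulliCharFun_sub_exp_le
        (hn (data Z n ω) i).1 (hn _ i).2 (c n (data Z n ω) i)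
      rw [Finset.sum_add_distrib, ← Finset.mul_sum] at h2
      have h5 : ‖((Real.exp (-(v / 2)) : ℝ) : ℂ) - (Real.exp (-(τ n / 2)) : ℝ)‖ ≤
          Real.exp (K / 2) * |v - τ n| := by
        rw [← ofReal_sub, norm_real]
        exact hlip v (τ n) K (by linarith [abs_nonneg C, hv0 ω]) (by linarith [le_abs_self C])
      refine (norm_sub_le_norm_sub_add_norm_sub _ ((Real.exp (-(v / 2)) : ℝ) : ℂ) _).trans ?_
      exact add_le_add (h1.trans h2) h5
  refine key.congr' ?_
  filter_upwards [hq01] with n hn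
  have hbm : AEMeasurable (fun ω => cexp (b n (data Z n ω) * I)) μ :=
    Complex.measurable_exp.comp_aemeasurable ((Complex.measurable_ofReal.comp_aemeasurable
      ((hb n).comp_aemeasurable (h.aemeasurable_data n))).mul_const I)
  have hpm : AEMeasurable (fun ω => ∏ i, bernoulliCharFun (q n (data Z n ω) i)
      (c n (data Z n ω) i)) μ := by
    refine Finset.aemeasurable_fun_prod _ fun i _ => ?_
    exact measurable_bernoulliCharFun.comp_aemeasurable
      (((hq n i).comp_aemeasurable (h.aemeasurable_data n)).prodMk
        ((hc n i).comp_aemeasurable (h.aemeasurable_data n)))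
  have hi1 : Integrable (fun ω => cexp (b n (data Z n ω) * I) *
      ∏ i, bernoulliCharFun (q n (data Z n ω) i) (c n (data Z n ω) i)) μ := by
    refine Integrable.of_bound (hbm.mul hpm).aestronglyMeasurable 1
      (Eventually.of_forall fun ω => ?_)
    rw [norm_mul, norm_exp_ofReal_mul_I, one_mul, norm_prod]
    exact Finset.prod_le_one (fun _ _ => norm_nonneg _)
        fun i _ => norm_bernoulliCharFun_le (hn _ i).1 (hn _ i).2 _
  have hi2 : Integrable (fun ω => cexp (b n (data Z n ω) * I)) μ :=
    Integrable.of_bound hbm.aestronglyMeasurable 1 (Eventually.of_forall fun ω => by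
      rw [norm_exp_ofReal_mul_I])
  simp_rw [mul_sub]
  rw [integral_sub hi1 (hi2.mul_const _), integral_mul_const,
    ← h.integral_exp_eq (hb n) (hc n) (hq n) hn]
  rfl

end Sampling

/-! ### Limit theorems for the full data. -/

section IID

open Complex

variable {𝒵 Ω : Type*} [MeasurableSpace 𝒵] [MeasurableSpace Ω] {μ : Measure Ω}
  {P : Measure 𝒵} {Z : ℕ → Ω → 𝒵} {U : (n : ℕ) → Fin n → Ω → ℝ}

lemma IsSamplingScheme.identDistrib_comp (h : IsSamplingScheme μ P Z U) {f : 𝒵 → ℝ}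
    (hf : AEMeasurable f P) (i : ℕ) : IdentDistrib (fun ω => f (Z i ω)) f μ P := by
  have e : IdentDistrib (Z i) id μ P :=
    ⟨(h.law_data i).aemeasurable, aemeasurable_id, by simp [(h.law_data i).map_eq]⟩
  exact e.comp_of_aemeasurable (u := f) (by rwa [(h.law_data i).map_eq])

lemma IsSamplingScheme.iIndepFun_comp (h : IsSamplingScheme μ P Z U) {f : 𝒵 → ℝ}
    (hf : AEMeasurable f P) : iIndepFun (fun i ω => f (Z i ω)) μ := by
  refine h.indep_data.comp₀ (fun _ => f) (fun i => (h.law_data i).aemeasurable) fun i => ?_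
  rwa [(h.law_data i).map_eq]

variable [IsProbabilityMeasure μ]

/-- The weak law of large numbers. -/
lemma IsSamplingScheme.tendstoInMeasure_average (h : IsSamplingScheme μ P Z U) {f : 𝒵 → ℝ}
    (hf : Integrable f P) : TendstoInMeasure μ
      (fun (n : ℕ) ω => (1 / (n : ℝ)) * ∑ i, f (data Z n ω i)) atTop (fun _ => ∫ z, f z ∂P) := by
  have hfm := hf.aestronglyMeasurable.aemeasurable
  have hid := h.identDistrib_comp hfm
  have hcomp : ∀ i, AEMeasurable (fun ω => f (Z i ω)) μ := fun i => (hid i).aemeasurable_fst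
  have hind := h.iIndepFun_comp hfm
  have hs := strong_law_ae_real (fun i ω => f (Z i ω)) ((hid 0).integrable_iff.mpr hf)
    (fun i j hij => hind.indepFun hij) (fun i => (hid i).trans (hid 0).symm)
  have h0 : μ[fun ω => f (Z 0 ω)] = ∫ z, f z ∂P := (hid 0).integral_eq
  rw [h0] at hs
  have hfs : ∀ (n : ℕ) ω, (1 / (n : ℝ)) * ∑ i, f (data Z n ω i) =
      (∑ i ∈ Finset.range n, f (Z i ω)) / n := by
    intro n ω
    rw [Finset.sum_range (fun i => f (Z i ω)), one_div, div_eq_inv_mul]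
    rfl
  refine tendstoInMeasure_of_tendsto_ae (fun n => ?_) ?_
  · simp_rw [hfs]
    exact ((Finset.aemeasurable_fun_sum _ fun i _ => hcomp i).div_const _).aestronglyMeasurable
  · simp_rw [hfs]
    exact hs

/-- The central limit theorem for characteristic functions, along bounded scalings. -/
lemma IsSamplingScheme.tendsto_integral_exp_average (h : IsSamplingScheme μ P Z U) {f : 𝒵 → ℝ}
    (hf : MemLp f 2 P) (h0 : ∫ z, f z ∂P = 0) {a : ℕ → ℝ} {C : ℝ}
    (ha : ∀ᶠ n in atTop, |a n| ≤ C) :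
    Tendsto (fun n : ℕ => ∫ ω, cexp ((a n / √n * ∑ i, f (data Z n ω i) : ℝ) * I) ∂μ -
      (Real.exp (-(a n ^ 2 * (∫ z, f z ^ 2 ∂P) / 2)) : ℝ)) atTop (𝓝 0) := by
  have hfm := hf.aestronglyMeasurable.aemeasurable
  have : IsProbabilityMeasure P := (h.law_data 0).map_eq ▸
    Measure.isProbabilityMeasure_map (h.law_data 0).aemeasurable
  have hPf := Measure.isProbabilityMeasure_map hfm
  set φ := charFun (P.map f) with hφ
  set v : ℝ := ∫ z, f z ^ 2 ∂P with hv
  have hid := h.identDistrib_comp hfm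
  -- Centring and a finite second moment give `φ` the same expansion `1 - v t²/2 + o(t²)` at `0` as
  -- the Gaussian, so the two differ by `o(t²)`.
  have hmem : MemLp id 2 (P.map f) := (memLp_map_measure_iff (by fun_prop) hfm).mpr hf
  have htaylor : (fun t : ℝ => φ t - (1 - (v : ℂ) * t ^ 2 / 2)) =o[𝓝 0] fun t => t ^ 2 := by
    have h1 : ContDiff ℝ 2 φ := contDiff_charFun hmem
    have h2 := taylor_isLittleO_univ (f := φ) (x₀ := 0) (n := 2) h1
    simp only [sub_zero] at h2
    refine h2.congr_left fun t => ?_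
    rw [hφ, taylorWithinEval_charFun_two_zero hfm hmem]
    simp [h0, hv]
  have hexp : (fun t : ℝ => ((Real.exp (-(v * t ^ 2 / 2)) : ℝ) : ℂ) - (1 - (v : ℂ) * t ^ 2 / 2))
      =o[𝓝 0] fun t => t ^ 2 := by
    have h1 : Tendsto (fun t : ℝ => -(v * t ^ 2 / 2)) (𝓝 0) (𝓝 0) := by
      have : Continuous fun t : ℝ => -(v * t ^ 2 / 2) := by fun_prop
      simpa using this.tendsto 0
    have h2 := (Real.exp_sub_sum_range_succ_isLittleO_pow 1).comp_tendsto h1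
    have h3 : ((fun x : ℝ => x ^ 1) ∘ fun t : ℝ => -(v * t ^ 2 / 2)) =O[𝓝 0]
        fun t : ℝ => t ^ 2 := by
      refine Asymptotics.IsBigO.of_bound |v / 2| (Eventually.of_forall fun t => le_of_eq ?_)
      simp only [Function.comp_apply, pow_one, Real.norm_eq_abs]
      rw [← abs_mul, ← abs_neg]
      congr 1
      ring
    refine Asymptotics.IsLittleO.of_norm_left ((h2.trans_isBigO h3).norm_left.congr_left ?_)
    intro t
    simp only [Function.comp_apply, Finset.sum_range_succ, Finset.sum_range_zero]
    rw [← norm_real]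
    congr 1
    push_cast
    simp
    ring
  have hdiff := htaylor.sub hexp
  simp only [sub_sub_sub_cancel_right] at hdiff
  have hx : Tendsto (fun n : ℕ => (√(n : ℝ))⁻¹ * a n) atTop (𝓝 0) := by
    refine squeeze_zero_norm' (a := fun n : ℕ => (√(n : ℝ))⁻¹ * C) ?_ ?_
    · filter_upwards [ha] with n hn
      rw [norm_mul, norm_inv, Real.norm_of_nonneg (Real.sqrt_nonneg _)]
      gcongr
      exact hn
    · rw [← zero_mul C]
      exact .mul_const C (tendsto_inv_atTop_zero.comp <| Real.tendsto_sqrt_atTop.comp <|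
        tendsto_natCast_atTop_atTop)
  have hcf : ∀ n : ℕ, ∫ ω, cexp ((a n / √n * ∑ i, f (data Z n ω i) : ℝ) * I) ∂μ =
      φ ((√(n : ℝ))⁻¹ * a n) ^ n := by
    intro n
    have h1 := charFun_inv_sqrt_mul_sum (h.iIndepFun_comp hfm)
      (fun i => (hid i).trans (hid 0).symm) (n := n) (t := a n)
    rw [(hid 0).map_eq] at h1
    rw [hφ, ← h1, charFun_apply_real, integral_map _ (by fun_prop)]
    · refine integral_congr_ae (Eventually.of_forall fun ω => ?_)
      simp only
      rw [Finset.sum_range (fun i => f (Z i ω))]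
      congr 2
      rw [← ofReal_mul]
      congr 1
      simp only [data]
      ring
    · exact (Finset.aemeasurable_fun_sum _ fun i _ => (hid i).aemeasurable_fst).const_mul _
  rw [Metric.tendsto_nhds]
  intro ε hε
  have hC : 0 < C ^ 2 + 1 := by positivity
  have hsmall := hx.eventually (hdiff.def (show 0 < ε / (C ^ 2 + 1) by positivity))
  filter_upwards [hsmall, ha, eventually_gt_atTop 0] with n h1 h2 hn0
  have hn : (0 : ℝ) < n := by exact_mod_cast hn0
  set x := (√(n : ℝ))⁻¹ * a n with hxdef
  have hx2 : (n : ℝ) * x ^ 2 = a n ^ 2 := by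
    rw [hxdef, mul_pow, inv_pow, Real.sq_sqrt hn.le]
    field_simp
  have hv0 : 0 ≤ v := integral_nonneg fun z => sq_nonneg _
  have hpow : ((Real.exp (-(a n ^ 2 * v / 2)) : ℝ) : ℂ) =
      ((Real.exp (-(v * x ^ 2 / 2)) : ℝ) : ℂ) ^ n := by
    rw [← ofReal_pow, ← Real.exp_nat_mul, ← hx2]
    congr 2
    ring
  rw [dist_zero_right, hcf, hpow]
  -- Each of the `n` factors errs by at most `ε/(C² + 1) · x²`, and `n x² = a_n² ≤ C²`; the `+ 1`
  -- keeps the final inequality strict.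
  have h3 := norm_prod_sub_prod_le (Finset.range n) (fun _ => φ x)
    (fun _ => ((Real.exp (-(v * x ^ 2 / 2)) : ℝ) : ℂ)) (fun _ _ => norm_charFun_le_one _)
    (fun _ _ => by
      rw [norm_real, Real.norm_of_nonneg (Real.exp_pos _).le]
      exact Real.exp_le_one_iff.mpr (by simp only [Left.neg_nonpos_iff]; positivity))
  simp only [Finset.prod_const, Finset.card_range, Finset.sum_const, nsmul_eq_mul] at h3
  calc _ ≤ _ := h3
    _ ≤ n * (ε / (C ^ 2 + 1) * ‖x ^ 2‖) := by gcongr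
    _ = ε / (C ^ 2 + 1) * a n ^ 2 := by
      rw [Real.norm_of_nonneg (sq_nonneg x), ← hx2]; ring
    _ ≤ ε / (C ^ 2 + 1) * C ^ 2 := by
      gcongr ?_ * ?_
      exact sq_le_sq' (by linarith [abs_le.mp h2]) (abs_le.mp h2).2
    _ < ε := by
      rw [div_mul_eq_mul_div, div_lt_iff₀ hC]
      nlinarith

end IID

/-! ### Deterministic analysis of concave maximizers. -/

section Calculus

variable {𝒵 : Type*} {d : ℕ} {Θ : Set (EuclideanSpace ℝ (Fin d))}
  {θ₀ : EuclideanSpace ℝ (Fin d)}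

open scoped RealInnerProductSpace

/-- The matrix unit with entry `1` at `(k, l)`, as an operator. -/
def unitOp (k l : Fin d) : EuclideanSpace ℝ (Fin d) →L[ℝ] EuclideanSpace ℝ (Fin d) :=
  (EuclideanSpace.proj l : EuclideanSpace ℝ (Fin d) →L[ℝ] ℝ).smulRight (EuclideanSpace.single k 1)

lemma norm_unitOp_le (k l : Fin d) : ‖unitOp k l‖ ≤ 1 := by
  refine ContinuousLinearMap.opNorm_le_bound _ zero_le_one fun v => ?_
  simp only [unitOp, ContinuousLinearMap.smulRight_apply, PiLp.proj_apply, norm_smul,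
    PiLp.norm_single, norm_one, mul_one, one_mul]
  exact PiLp.norm_apply_le v l

lemma eq_sum_single (v : EuclideanSpace ℝ (Fin d)) :
    v = ∑ k, v k • EuclideanSpace.single k (1 : ℝ) := by
  have := (EuclideanSpace.basisFun (Fin d) ℝ).sum_repr v
  simpa using this.symm

lemma eq_sum_unitOp (L : EuclideanSpace ℝ (Fin d) →L[ℝ] EuclideanSpace ℝ (Fin d)) :
    L = ∑ k, ∑ l, (L (EuclideanSpace.single l 1)) k • unitOp k l := by
  ext1 v
  conv_lhs => rw [eq_sum_single v, map_sum]
  simp only [_root_.sum_apply, _root_.smul_apply, unitOp,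
    ContinuousLinearMap.smulRight_apply, PiLp.proj_apply]
  rw [Finset.sum_comm]
  refine Finset.sum_congr rfl fun l _ => ?_
  rw [map_smul]
  conv_lhs => rw [eq_sum_single (L (EuclideanSpace.single l 1)), Finset.smul_sum]
  exact Finset.sum_congr rfl fun k _ => smul_comm _ _ _

lemma norm_le_sum_abs_entries
    (L : EuclideanSpace ℝ (Fin d) →L[ℝ] EuclideanSpace ℝ (Fin d)) :
    ‖L‖ ≤ ∑ k, ∑ l, |(L (EuclideanSpace.single l 1)) k| := by
  conv_lhs => rw [eq_sum_unitOp L]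
  refine (norm_sum_le _ _).trans (Finset.sum_le_sum fun k _ =>
    (norm_sum_le _ _).trans (Finset.sum_le_sum fun l _ => ?_))
  rw [norm_smul, Real.norm_eq_abs]
  exact mul_le_of_le_one_right (abs_nonneg _) (norm_unitOp_le k l)

/-- The second derivative of `f` within `Θ`, as an operator. -/
def hessianOp (Θ : Set (EuclideanSpace ℝ (Fin d))) (f : EuclideanSpace ℝ (Fin d) → ℝ)
    (θ : EuclideanSpace ℝ (Fin d)) : EuclideanSpace ℝ (Fin d) →L[ℝ] EuclideanSpace ℝ (Fin d) :=
  fderivWithin ℝ (gradientWithin f Θ) Θ θ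

lemma hessianOp_single (f : EuclideanSpace ℝ (Fin d) → ℝ) (θ : EuclideanSpace ℝ (Fin d))
    (k l : Fin d) : (hessianOp Θ f θ (EuclideanSpace.single l 1)) k = hessian Θ f θ k l := rfl

/-- Bridge between the matrices used for definiteness and inversion and the operators used in Taylor
expansions. -/
lemma toEuclideanCLM_hessian (f : EuclideanSpace ℝ (Fin d) → ℝ)
    (θ : EuclideanSpace ℝ (Fin d)) :
    Matrix.toEuclideanCLM (𝕜 := ℝ) (hessian Θ f θ) = hessianOp Θ f θ := by
  rw [eq_sum_unitOp (hessianOp Θ f θ), eq_sum_unitOp (Matrix.toEuclideanCLM (𝕜 := ℝ) (hessian Θ f θ))]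
  refine Finset.sum_congr rfl fun k _ => Finset.sum_congr rfl fun l _ => ?_
  rw [hessianOp_single]
  congr 1
  rw [Matrix.ofLp_toEuclideanCLM]
  simp

lemma hasFDerivAt_of_mem_interior {f : EuclideanSpace ℝ (Fin d) → ℝ}
    (hf : DifferentiableOn ℝ f Θ) {θ : EuclideanSpace ℝ (Fin d)} (hθ : θ ∈ interior Θ) :
    HasFDerivAt f (innerSL ℝ (gradientWithin f Θ θ)) θ := by
  have h := (hf θ (interior_subset hθ)).hasFDerivWithinAt.hasFDerivAt
    (mem_interior_iff_mem_nhds.mp hθ)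
  have e : innerSL ℝ (gradientWithin f Θ θ) = fderivWithin ℝ f Θ θ := by
    rw [← toDual_gradientWithin]
    rfl
  rwa [e]

lemma hasFDerivAt_gradient_of_mem_interior {f : EuclideanSpace ℝ (Fin d) → ℝ}
    (hf : DifferentiableOn ℝ (gradientWithin f Θ) Θ) {θ : EuclideanSpace ℝ (Fin d)}
    (hθ : θ ∈ interior Θ) : HasFDerivAt (gradientWithin f Θ) (hessianOp Θ f θ) θ :=
  (hf θ (interior_subset hθ)).hasFDerivWithinAt.hasFDerivAt (mem_interior_iff_mem_nhds.mp hθ)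

/-- The Hessian of `f` has entries which are `c`-Lipschitz on `Θ`. -/
def HessianLipschitz (Θ : Set (EuclideanSpace ℝ (Fin d))) (f : EuclideanSpace ℝ (Fin d) → ℝ)
    (c : ℝ) : Prop :=
  ∀ θ₁ ∈ Θ, ∀ θ₂ ∈ Θ, ∀ k l, |hessian Θ f θ₁ k l - hessian Θ f θ₂ k l| ≤ c * ‖θ₁ - θ₂‖

lemma HessianLipschitz.norm_hessianOp_sub_le {f : EuclideanSpace ℝ (Fin d) → ℝ} {c : ℝ}
    (h : HessianLipschitz Θ f c) {θ₁ θ₂ : EuclideanSpace ℝ (Fin d)} (h₁ : θ₁ ∈ Θ)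
    (h₂ : θ₂ ∈ Θ) : ‖hessianOp Θ f θ₁ - hessianOp Θ f θ₂‖ ≤ (d ^ 2 * |c|) * ‖θ₁ - θ₂‖ := by
  refine (norm_le_sum_abs_entries _).trans ?_
  calc _ ≤ ∑ _k : Fin d, ∑ _l : Fin d, |c| * ‖θ₁ - θ₂‖ :=
        Finset.sum_le_sum fun k _ => Finset.sum_le_sum fun l _ => by
          refine (h θ₁ h₁ θ₂ h₂ k l).trans ?_
          gcongr
          exact le_abs_self c
    _ = _ := by simp; ring

/-- First order Taylor expansion of the gradient. -/
lemma HessianLipschitz.norm_gradient_sub_le {f : EuclideanSpace ℝ (Fin d) → ℝ} {c : ℝ}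
    (h : HessianLipschitz Θ f c) (hf : DifferentiableOn ℝ (gradientWithin f Θ) Θ)
    {r : ℝ} (hr : Metric.closedBall θ₀ r ⊆ interior Θ) {θ : EuclideanSpace ℝ (Fin d)}
    (hθ : ‖θ - θ₀‖ ≤ r) :
    ‖gradientWithin f Θ θ - gradientWithin f Θ θ₀ - hessianOp Θ f θ₀ (θ - θ₀)‖ ≤
      (d ^ 2 * |c|) * ‖θ - θ₀‖ ^ 2 := by
  have hsub : Metric.closedBall θ₀ ‖θ - θ₀‖ ⊆ interior Θ :=
    (Metric.closedBall_subset_closedBall hθ).trans hr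
  have h0 : θ₀ ∈ Metric.closedBall θ₀ ‖θ - θ₀‖ := Metric.mem_closedBall_self (norm_nonneg _)
  have := Convex.norm_image_sub_le_of_norm_hasFDerivWithin_le'
    (f := gradientWithin f Θ) (f' := hessianOp Θ f) (s := Metric.closedBall θ₀ ‖θ - θ₀‖)
    (φ := hessianOp Θ f θ₀) (x := θ₀) (y := θ) (C := (d ^ 2 * |c|) * ‖θ - θ₀‖)
    (fun x hx => (hasFDerivAt_gradient_of_mem_interior hf (hsub hx)).hasFDerivWithinAt)
    (fun x hx => (h.norm_hessianOp_sub_le (interior_subset (hsub hx))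
      (interior_subset (hsub h0))).trans (by
        gcongr
        exact mem_closedBall_iff_norm.mp hx))
    (convex_closedBall _ _) h0 (by simp [dist_eq_norm])
  refine this.trans (le_of_eq ?_)
  ring

/-- Quantitative consistency and linearization of the maximizer of a concave weighted sum. -/
lemma norm_argmax_sub_le {ι : Type*} [Fintype ι] {w ψ : ι → ℝ}
    {f : ι → EuclideanSpace ℝ (Fin d) → ℝ} (hw : ∀ i, 0 ≤ w i)
    (hconc : ∀ i, ConcaveOn ℝ Θ (f i)) (hΘ : Convex ℝ Θ)
    (hdiff : ∀ i, DifferentiableOn ℝ (f i) Θ)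
    (hdiff2 : ∀ i, DifferentiableOn ℝ (gradientWithin (f i) Θ) Θ)
    (hlip : ∀ i, HessianLipschitz Θ (f i) (ψ i))
    {r lam ρ : ℝ} (hr : Metric.closedBall θ₀ r ⊆ interior Θ) (hr0 : 0 < r) (hlam : 0 < lam)
    {A : EuclideanSpace ℝ (Fin d) →L[ℝ] EuclideanSpace ℝ (Fin d)}
    (hA : ∀ v, ⟪v, A v⟫ ≤ -lam * ‖v‖ ^ 2) (hρ : ‖∑ i, w i • hessianOp Θ (f i) θ₀ - A‖ ≤ ρ)
    (hρlam : ρ ≤ lam / 4) (hR : d ^ 2 * (∑ i, w i * |ψ i|) * r ≤ lam / 4)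
    (hg : 2 * ‖∑ i, w i • gradientWithin (f i) Θ θ₀‖ < lam * r)
    {θ : EuclideanSpace ℝ (Fin d)} (hθ : θ ∈ Θ) (hmax : IsMaxOn (fun x => ∑ i, w i * f i x) Θ θ) :
    ‖θ - θ₀‖ ≤ 2 / lam * ‖∑ i, w i • gradientWithin (f i) Θ θ₀‖ ∧
    ‖∑ i, w i • gradientWithin (f i) Θ θ₀ + A (θ - θ₀)‖ ≤
      (d ^ 2 * (∑ i, w i * |ψ i|) * ‖θ - θ₀‖ + ρ) * ‖θ - θ₀‖ := by
  set g := ∑ i, w i • gradientWithin (f i) Θ θ₀ with hgdef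
  set An := ∑ i, w i • hessianOp Θ (f i) θ₀ with hAn
  set R : ℝ := d ^ 2 * (∑ i, w i * |ψ i|) with hRdef
  have hR0 : 0 ≤ R := mul_nonneg (by positivity)
    (Finset.sum_nonneg fun i _ => mul_nonneg (hw i) (abs_nonneg _))
  set G : EuclideanSpace ℝ (Fin d) → ℝ := fun x => ∑ i, w i * f i x with hG
  set γ : EuclideanSpace ℝ (Fin d) → EuclideanSpace ℝ (Fin d) :=
    fun x => ∑ i, w i • gradientWithin (f i) Θ x with hγ
  have hGconc : ConcaveOn ℝ Θ G := by
    refine ⟨hΘ, fun x hx y hy a b ha hb hab => ?_⟩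
    simp only [hG, smul_eq_mul, Finset.mul_sum]
    rw [← Finset.sum_add_distrib]
    refine Finset.sum_le_sum fun i _ => ?_
    have := mul_le_mul_of_nonneg_left ((hconc i).2 hx hy ha hb hab) (hw i)
    simp only [smul_eq_mul] at this
    linarith
  have hGder : ∀ x ∈ interior Θ, HasFDerivAt G (innerSL ℝ (γ x)) x := by
    intro x hx
    have h1 : HasFDerivAt G (∑ i, w i • innerSL ℝ (gradientWithin (f i) Θ x)) x := by
      refine HasFDerivAt.fun_sum fun i _ => ?_
      exact (hasFDerivAt_of_mem_interior (hdiff i) hx).const_mul (w i)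
    convert h1 using 1
    simp [hγ, map_sum]
  have htaylor : ∀ x, ‖x - θ₀‖ ≤ r → ‖γ x - g - An (x - θ₀)‖ ≤ R * ‖x - θ₀‖ ^ 2 := by
    intro x hx
    have e : γ x - g - An (x - θ₀) = ∑ i, w i • (gradientWithin (f i) Θ x -
        gradientWithin (f i) Θ θ₀ - hessianOp Θ (f i) θ₀ (x - θ₀)) := by
      simp only [hγ, hgdef, hAn, _root_.sum_apply, _root_.smul_apply,
        smul_sub, Finset.sum_sub_distrib]
    rw [e]
    refine (norm_sum_le _ _).trans ?_
    rw [hRdef, Finset.mul_sum, Finset.sum_mul]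
    refine Finset.sum_le_sum fun i _ => ?_
    rw [norm_smul, Real.norm_of_nonneg (hw i)]
    calc _ ≤ w i * ((d ^ 2 * |ψ i|) * ‖x - θ₀‖ ^ 2) := by
          gcongr
          · exact hw i
          · exact (hlip i).norm_gradient_sub_le (hdiff2 i) hr hx
      _ = _ := by ring
  have hθ₀ : θ₀ ∈ interior Θ := hr (Metric.mem_closedBall_self hr0.le)
  have hAnA : ∀ v, ‖An v - A v‖ ≤ ρ * ‖v‖ := fun v => by
    rw [← _root_.sub_apply]
    exact ((An - A).le_opNorm v).trans (by gcongr)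
  -- This is proved for every point between `θ₀` and `θ` inside the ball, not only for `θ`, because
  -- `θ` is not yet known to be in the ball.
  have hclaim : ∀ x, Wbtw ℝ θ₀ x θ → ‖x - θ₀‖ ≤ r → ‖x - θ₀‖ ≤ 2 / lam * ‖g‖ := by
    intro x hx hxr
    have hxint : x ∈ interior Θ := hr (mem_closedBall_iff_norm.mpr hxr)
    -- If `y` lies between `θ₀` and `x`, then `x` lies between `y` and the maximizer `θ`; concavity
    -- gives `G x ≥ min (G y) (G θ) = G y`.
    have hmaxseg : IsMaxOn G (segment ℝ x θ₀) x := by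
      intro y hy
      rw [segment_symm] at hy
      have hy' := mem_segment_iff_wbtw.mp hy
      have hyΘ : y ∈ Θ := hΘ.segment_subset (interior_subset hθ₀) (interior_subset hxint) hy
      have h1 := hGconc.ge_on_segment hyΘ hθ
        (mem_segment_iff_wbtw.mpr (hx.trans_left_right hy'))
      rwa [min_eq_left (hmax hyΘ)] at h1
    have h1 := hmaxseg.localize.hasFDerivWithinAt_nonpos (hGder x hxint).hasFDerivWithinAt
      (sub_mem_posTangentConeAt_of_segment_subset subset_rfl)
    rw [innerSL_apply_apply] at h1
    set v := x - θ₀ with hv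
    have h2 : 0 ≤ ⟪γ x, v⟫ := by
      have : ⟪γ x, v⟫ = -⟪γ x, θ₀ - x⟫ := by rw [← inner_neg_right, neg_sub]
      linarith
    -- The Taylor and Hessian errors each use up at most `lam/4 · ‖v‖²` of the curvature `lam ‖v‖²`,
    -- so `0 ≤ ‖g‖ ‖v‖ - lam/2 · ‖v‖²`.
    have h3 : ⟪γ x, v⟫ = ⟪γ x - g - An v, v⟫ + ⟪g, v⟫ + ⟪An v - A v, v⟫ + ⟪v, A v⟫ := by
      rw [inner_sub_left, inner_sub_left, inner_sub_left, real_inner_comm v (A v)]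
      ring
    have h4 : ⟪γ x - g - An v, v⟫ ≤ R * ‖v‖ ^ 2 * ‖v‖ :=
      (real_inner_le_norm _ _).trans (by gcongr; exact htaylor x hxr)
    have h5 : ⟪g, v⟫ ≤ ‖g‖ * ‖v‖ := real_inner_le_norm _ _
    have h6 : ⟪An v - A v, v⟫ ≤ ρ * ‖v‖ * ‖v‖ :=
      (real_inner_le_norm _ _).trans (by gcongr; exact hAnA v)
    have h7 := hA v
    have h8 : R * ‖v‖ ≤ lam / 4 := (mul_le_mul_of_nonneg_left hxr hR0).trans hR
    rcases (norm_nonneg v).eq_or_lt with h0 | h0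
    · rw [← h0]; positivity
    · have h9 : 0 ≤ ‖v‖ * (‖g‖ - lam / 2 * ‖v‖) := by
        have h10 : R * ‖v‖ ^ 2 * ‖v‖ ≤ lam / 4 * ‖v‖ ^ 2 := by
          calc R * ‖v‖ ^ 2 * ‖v‖ = R * ‖v‖ * ‖v‖ ^ 2 := by ring
            _ ≤ _ := by gcongr
        have h11 : ρ * ‖v‖ * ‖v‖ ≤ lam / 4 * ‖v‖ ^ 2 := by
          calc ρ * ‖v‖ * ‖v‖ = ρ * ‖v‖ ^ 2 := by ring
            _ ≤ _ := by gcongr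
        nlinarith
      have h10 : 0 ≤ ‖g‖ - lam / 2 * ‖v‖ := nonneg_of_mul_nonneg_right h9 h0
      rw [div_mul_eq_mul_div, le_div_iff₀ hlam]
      linarith
  have hgr : 2 / lam * ‖g‖ < r := by
    rw [div_mul_eq_mul_div, div_lt_iff₀ hlam]
    linarith
  have hle : ‖θ - θ₀‖ ≤ r := by
    by_contra! hlt
    have h0 : 0 < ‖θ - θ₀‖ := hr0.trans hlt
    -- Were `θ` outside the ball, the point where the segment crosses the sphere of radius `r` would
    -- violate the claim.
    have hx := hclaim (AffineMap.lineMap θ₀ θ (r / ‖θ - θ₀‖))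
      ⟨_, ⟨by positivity, (div_le_one h0).mpr hlt.le⟩, rfl⟩
    have hn : ‖AffineMap.lineMap θ₀ θ (r / ‖θ - θ₀‖) - θ₀‖ = r := by
      rw [AffineMap.lineMap_apply, vsub_eq_sub, vadd_eq_add, add_sub_cancel_right, norm_smul,
        Real.norm_of_nonneg (by positivity), div_mul_cancel₀ _ h0.ne']
    rw [hn] at hx
    exact absurd (hx le_rfl) (not_le.mpr hgr)
  refine ⟨hclaim θ (wbtw_self_right ℝ _ _) hle, ?_⟩
  have hθint : θ ∈ interior Θ := hr (mem_closedBall_iff_norm.mpr hle)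
  have hγ0 : γ θ = 0 := by
    have h1 := (hmax.isLocalMax (mem_interior_iff_mem_nhds.mp hθint)).hasFDerivAt_eq_zero
      (hGder θ hθint)
    have h2 : ⟪γ θ, γ θ⟫ = 0 := by
      have := congrArg (fun L => L (γ θ)) h1
      simpa using this
    exact inner_self_eq_zero.mp h2
  have h1 := htaylor θ hle
  have h2 := hAnA (θ - θ₀)
  rw [hγ0] at h1
  have e : g + A (θ - θ₀) = -(0 - g - An (θ - θ₀)) - (An (θ - θ₀) - A (θ - θ₀)) := by abel
  rw [e]
  refine (norm_sub_le _ _).trans ?_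
  rw [norm_neg]
  linarith

/-- A negative definite matrix is uniformly negative definite. -/
lemma exists_inner_le_of_posDef_neg {A : Matrix (Fin d) (Fin d) ℝ} (hA : (-A).PosDef) :
    ∃ lam : ℝ, 0 < lam ∧ ∀ v, ⟪v, Matrix.toEuclideanCLM (𝕜 := ℝ) A v⟫ ≤ -lam * ‖v‖ ^ 2 := by
  set L := Matrix.toEuclideanCLM (𝕜 := ℝ) A with hL
  have hneg : ∀ v : EuclideanSpace ℝ (Fin d), v ≠ 0 → ⟪v, L v⟫ < 0 := by
    intro v hv
    rw [hL, Matrix.inner_toEuclideanCLM]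
    have := hA.dotProduct_mulVec_pos (x := v.ofLp) (by simpa using hv)
    rw [Matrix.neg_mulVec, dotProduct_neg] at this
    simpa using this
  have hcont : Continuous fun v : EuclideanSpace ℝ (Fin d) => ⟪v, L v⟫ := by fun_prop
  -- The sphere is empty in dimension zero. Otherwise `lam` is minus the maximum of the quadratic
  -- form over it.
  rcases (Metric.sphere (0 : EuclideanSpace ℝ (Fin d)) 1).eq_empty_or_nonempty with he | hne
  · refine ⟨1, one_pos, fun v => ?_⟩
    have hv : v = 0 := by
      by_contra hv
      have : ‖v‖⁻¹ • v ∈ Metric.sphere (0 : EuclideanSpace ℝ (Fin d)) 1 := by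
        simp [norm_smul, hv]
      rw [he] at this
      exact this
    simp [hv]
  · obtain ⟨u, hu, hmax⟩ := (isCompact_sphere _ _).exists_isMaxOn hne hcont.continuousOn
    have hu1 : ‖u‖ = 1 := by simpa using hu
    refine ⟨-⟪u, L u⟫, neg_pos.mpr (hneg u (by rintro rfl; simp at hu1)), fun v => ?_⟩
    rcases eq_or_ne v 0 with rfl | hv
    · simp
    · have h1 : ⟪‖v‖⁻¹ • v, L (‖v‖⁻¹ • v)⟫ ≤ ⟪u, L u⟫ :=
        hmax (by simp [norm_smul, hv])
      rw [map_smul, real_inner_smul_left, real_inner_smul_right] at h1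
      have hv0 : 0 < ‖v‖ := norm_pos_iff.mpr hv
      have h2 : ⟪v, L v⟫ = (‖v‖⁻¹ * (‖v‖⁻¹ * ⟪v, L v⟫)) * ‖v‖ ^ 2 := by field_simp
      rw [h2, neg_neg]
      gcongr

end Calculus

/-! ### Differentiation of the population target under the integral. -/

section Population

open scoped RealInnerProductSpace

variable {𝒵 : Type*} [MeasurableSpace 𝒵] {d : ℕ} {P : Measure 𝒵}
  {Θ : Set (EuclideanSpace ℝ (Fin d))} {m : 𝒵 → EuclideanSpace ℝ (Fin d) → ℝ}
  {θ₀ : EuclideanSpace ℝ (Fin d)}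

lemma memLp_of_forall_apply {f : 𝒵 → EuclideanSpace ℝ (Fin d)}
    (h : ∀ k, MemLp (fun z => f z k) 2 P) : MemLp f 2 P := by
  have : f = fun z => ∑ k, f z k • EuclideanSpace.single k (1 : ℝ) := by
    ext1 z; exact eq_sum_single _
  rw [this]
  exact memLp_finsetSum _ fun k _ =>
    (ContinuousLinearMap.toSpanSingleton ℝ (EuclideanSpace.single k (1 : ℝ))).comp_memLp' (h k)

lemma integrable_sum_sum_smul {ι F : Type*} [Fintype ι] [NormedAddCommGroup F] [NormedSpace ℝ F]
    {c : 𝒵 → ι → ι → ℝ} (hc : ∀ k l, Integrable (fun z => c z k l) P) (e : ι → ι → F) :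
    Integrable (fun z => ∑ k, ∑ l, c z k l • e k l) P :=
  integrable_finsetSum _ fun k _ => integrable_finsetSum _ fun l _ => (hc k l).smul_const _

variable [IsProbabilityMeasure P]

lemma ScoreRegular.integrable (h : ScoreRegular P Θ m) {θ : EuclideanSpace ℝ (Fin d)}
    (hθ : θ ∈ Θ) : Integrable (fun z => gradientWithin (m z) Θ θ) P :=
  (memLp_of_forall_apply (h.sq_integrable θ hθ)).integrable one_le_two

lemma HessianRegular.integrable (h : HessianRegular P Θ m) {θ : EuclideanSpace ℝ (Fin d)}
    (hθ : θ ∈ Θ) : Integrable (fun z => hessianOp Θ (m z) θ) P :=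
  (integrable_sum_sum_smul (fun k l => (h.sq_integrable θ hθ k l).integrable one_le_two)
    unitOp).congr (Eventually.of_forall fun _ => (eq_sum_unitOp _).symm)

/-- A local integrable envelope for the gradient and the Hessian. -/
lemma exists_envelope (hHess : HessianRegular P Θ m) (hScore : ScoreRegular P Θ m) {r : ℝ}
    (hr : Metric.closedBall θ₀ r ⊆ interior Θ) (hr0 : 0 < r) :
    ∃ B : 𝒵 → ℝ, Integrable B P ∧ ∀ z, ∀ θ ∈ Metric.closedBall θ₀ r,
      ‖gradientWithin (m z) Θ θ‖ ≤ B z ∧ ‖hessianOp Θ (m z) θ‖ ≤ B z := by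
  have hθ₀ : θ₀ ∈ Θ := interior_subset (hr (Metric.mem_closedBall_self hr0.le))
  obtain ⟨ψ, hψ, hlip⟩ := hHess.lipschitz
  have hlip' : ∀ z, HessianLipschitz Θ (m z) (ψ z) := hlip
  refine ⟨fun z => ‖gradientWithin (m z) Θ θ₀‖ + (1 + r) * (‖hessianOp Θ (m z) θ₀‖ +
    d ^ 2 * |ψ z| * r), ?_, fun z θ hθ => ?_⟩
  · exact (hScore.integrable hθ₀).norm.add (((hHess.integrable hθ₀).norm.add
      (((hψ.integrable one_le_two).abs.const_mul _).mul_const _)).const_mul _)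
  · have hθr : ‖θ - θ₀‖ ≤ r := mem_closedBall_iff_norm.mp hθ
    have h1 := (hlip' z).norm_gradient_sub_le (hHess.differentiable_grad z) hr hθr
    have h2 := (hlip' z).norm_hessianOp_sub_le (interior_subset (hr hθ)) hθ₀
    set L := hessianOp Θ (m z) θ₀
    have hψ0 : 0 ≤ d ^ 2 * |ψ z| := by positivity
    have hL := norm_nonneg L
    have h3 : ‖L (θ - θ₀)‖ ≤ ‖L‖ * r := (L.le_opNorm _).trans (by gcongr)
    have h4 : d ^ 2 * |ψ z| * ‖θ - θ₀‖ ≤ d ^ 2 * |ψ z| * r := by gcongr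
    have h5 : d ^ 2 * |ψ z| * ‖θ - θ₀‖ ^ 2 ≤ d ^ 2 * |ψ z| * r * r := by
      rw [mul_assoc _ r r, ← sq]; gcongr
    have h6 : gradientWithin (m z) Θ θ = (gradientWithin (m z) Θ θ - gradientWithin (m z) Θ θ₀ -
      L (θ - θ₀)) + gradientWithin (m z) Θ θ₀ + L (θ - θ₀) := by abel
    have h7 : hessianOp Θ (m z) θ = (hessianOp Θ (m z) θ - L) + L := by abel
    constructor
    · rw [h6]
      refine (norm_add₃_le).trans ?_
      nlinarith [mul_nonneg hψ0 hr0.le]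
    · rw [h7]
      refine (norm_add_le _ _).trans ?_
      nlinarith [mul_nonneg hψ0 hr0.le, mul_nonneg (mul_nonneg hψ0 hr0.le) hr0.le,
        norm_nonneg (gradientWithin (m z) Θ θ₀), mul_nonneg hr0.le hL]

/-- Dominated differentiation, with the envelope on a small closed ball as integrable bound. -/
lemma hasFDerivAt_popTarget (hm : ConcaveTarget P Θ m) (hHess : HessianRegular P Θ m)
    (hScore : ScoreRegular P Θ m) {θ : EuclideanSpace ℝ (Fin d)} (hθ : θ ∈ interior Θ) :
    HasFDerivAt (popTarget P m) (innerSL ℝ (∫ z, gradientWithin (m z) Θ θ ∂P)) θ := by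
  obtain ⟨r, hr0, hr⟩ := Metric.nhds_basis_closedBall.mem_iff.mp (isOpen_interior.mem_nhds hθ)
  obtain ⟨B, hB, hBle⟩ := exists_envelope hHess hScore hr hr0
  have h := hasFDerivAt_integral_of_dominated_of_fderiv_le (μ := P) (F := fun x z => m z x)
    (F' := fun x z => innerSL ℝ (gradientWithin (m z) Θ x)) (bound := B)
    (Metric.closedBall_mem_nhds θ hr0)
    (by
      filter_upwards [Metric.closedBall_mem_nhds θ hr0] with x hx
      exact (hm.sq_integrable x (interior_subset (hr hx))).aestronglyMeasurable)
    ((hm.sq_integrable θ (interior_subset hθ)).integrable one_le_two)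
    ((innerSL ℝ).continuous.comp_aestronglyMeasurable
      (hScore.integrable (interior_subset hθ)).aestronglyMeasurable)
    (Eventually.of_forall fun z x hx => by
      rw [innerSL_apply_norm]; exact (hBle z x hx).1) hB
    (Eventually.of_forall fun z x hx =>
      hasFDerivAt_of_mem_interior (hHess.differentiable z) (hr hx))
  rwa [ContinuousLinearMap.integral_comp_comm _ (hScore.integrable (interior_subset hθ))] at h

lemma gradientWithin_popTarget (hm : ConcaveTarget P Θ m) (hHess : HessianRegular P Θ m)
    (hScore : ScoreRegular P Θ m) {θ : EuclideanSpace ℝ (Fin d)} (hθ : θ ∈ interior Θ) :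
    gradientWithin (popTarget P m) Θ θ = ∫ z, gradientWithin (m z) Θ θ ∂P := by
  have h := hasFDerivAt_popTarget hm hHess hScore hθ
  rw [gradientWithin, fderivWithin_of_mem_nhds (mem_interior_iff_mem_nhds.mp hθ), h.fderiv]
  exact (InnerProductSpace.toDual ℝ _).symm_apply_apply _

/-- The expected score vanishes at the true parameter. -/
lemma IsTrueParameter.integral_gradient_eq_zero (hθ₀ : IsTrueParameter P Θ m θ₀)
    (hm : ConcaveTarget P Θ m) (hHess : HessianRegular P Θ m) (hScore : ScoreRegular P Θ m) :
    ∫ z, gradientWithin (m z) Θ θ₀ ∂P = 0 := by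
  have hmax : IsMaxOn (popTarget P m) Θ θ₀ := by
    intro θ hθ
    change popTarget P m θ ≤ popTarget P m θ₀
    rcases eq_or_ne θ θ₀ with rfl | hne
    · exact le_rfl
    · exact (hθ₀.unique_max θ hθ hne).le
  have h := (hmax.isLocalMax (mem_interior_iff_mem_nhds.mp hθ₀.mem_interior)).hasFDerivAt_eq_zero
    (hasFDerivAt_popTarget hm hHess hScore hθ₀.mem_interior)
  have := congrArg (fun L => L (∫ z, gradientWithin (m z) Θ θ₀ ∂P)) h
  simpa using this

lemma hessianOp_popTarget (hm : ConcaveTarget P Θ m) (hHess : HessianRegular P Θ m)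
    (hScore : ScoreRegular P Θ m) {θ : EuclideanSpace ℝ (Fin d)} (hθ : θ ∈ interior Θ) :
    hessianOp Θ (popTarget P m) θ = ∫ z, hessianOp Θ (m z) θ ∂P := by
  obtain ⟨r, hr0, hr⟩ := Metric.nhds_basis_closedBall.mem_iff.mp (isOpen_interior.mem_nhds hθ)
  obtain ⟨B, hB, hBle⟩ := exists_envelope hHess hScore hr hr0
  have h := hasFDerivAt_integral_of_dominated_of_fderiv_le (μ := P)
    (F := fun x z => gradientWithin (m z) Θ x) (F' := fun x z => hessianOp Θ (m z) x) (bound := B)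
    (Metric.closedBall_mem_nhds θ hr0)
    (by
      filter_upwards [Metric.closedBall_mem_nhds θ hr0] with x hx
      exact (hScore.integrable (interior_subset (hr hx))).aestronglyMeasurable)
    (hScore.integrable (interior_subset hθ))
    (hHess.integrable (interior_subset hθ)).aestronglyMeasurable
    (Eventually.of_forall fun z x hx => (hBle z x hx).2) hB
    (Eventually.of_forall fun z x hx =>
      hasFDerivAt_gradient_of_mem_interior (hHess.differentiable_grad z) (hr hx))
  have he : gradientWithin (popTarget P m) Θ =ᶠ[𝓝 θ]
      fun x => ∫ z, gradientWithin (m z) Θ x ∂P := by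
    filter_upwards [isOpen_interior.mem_nhds hθ] with x hx
    exact gradientWithin_popTarget hm hHess hScore hx
  rw [hessianOp, fderivWithin_of_mem_nhds (mem_interior_iff_mem_nhds.mp hθ), he.fderiv_eq, h.fderiv]

/-- Carries the definiteness assumed of `E m̈` over to the Hessian of `M`, in which the limit
covariance is expressed. -/
lemma hessian_popTarget (hm : ConcaveTarget P Θ m) (hHess : HessianRegular P Θ m)
    (hScore : ScoreRegular P Θ m) {θ : EuclideanSpace ℝ (Fin d)} (hθ : θ ∈ interior Θ) :
    hessian Θ (popTarget P m) θ = expectedHessian P Θ m θ := by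
  ext k l
  have hi := hHess.integrable (interior_subset hθ)
  rw [← hessianOp_single, hessianOp_popTarget hm hHess hScore hθ,
    ContinuousLinearMap.integral_apply hi]
  have := (EuclideanSpace.proj k : EuclideanSpace ℝ (Fin d) →L[ℝ] ℝ).integral_comp_comm
    (hi.apply_continuousLinearMap (EuclideanSpace.single l 1))
  simp only [PiLp.proj_apply] at this
  rw [← this]
  rfl

end Population

/-! ### Stochastic linearization of weighted maximizers. -/

section Linearization

open scoped RealInnerProductSpace

variable {𝒵 Ω : Type*} [MeasurableSpace 𝒵] [MeasurableSpace Ω] {μ : Measure Ω}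
  {P : Measure 𝒵} [IsProbabilityMeasure P] {d : ℕ}
  {Θ : Set (EuclideanSpace ℝ (Fin d))} {m : 𝒵 → EuclideanSpace ℝ (Fin d) → ℝ}
  {θ₀ : EuclideanSpace ℝ (Fin d)} {Z : ℕ → Ω → 𝒵} {U : (n : ℕ) → Fin n → Ω → ℝ}

lemma norm_le_sum_abs_apply (v : EuclideanSpace ℝ (Fin d)) : ‖v‖ ≤ ∑ k, |v k| := by
  conv_lhs => rw [eq_sum_single v]
  refine (norm_sum_le _ _).trans (Finset.sum_le_sum fun k _ => ?_)
  simp [norm_smul]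

/-- The weighted score at `θ`. -/
def weightedScore {n : ℕ} (Θ : Set (EuclideanSpace ℝ (Fin d)))
    (m : 𝒵 → EuclideanSpace ℝ (Fin d) → ℝ) (w : Fin n → ℝ) (D : Fin n → 𝒵)
    (θ : EuclideanSpace ℝ (Fin d)) : EuclideanSpace ℝ (Fin d) :=
  ∑ i, w i • gradientWithin (m (D i)) Θ θ

/-- Random weights for which weighted sums of square integrable functions of the data obey the
weak law of large numbers. -/
structure WeightedLLN (μ : Measure Ω) (P : Measure 𝒵) (Z : ℕ → Ω → 𝒵)
    (w : (n : ℕ) → Ω → Fin n → ℝ) : Prop where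
  nonneg : ∀ᶠ n in atTop, ∀ ω i, 0 ≤ w n ω i
  tendsto : ∀ f : 𝒵 → ℝ, MemLp f 2 P → TendstoInMeasure μ
    (fun n ω => ∑ i, w n ω i * f (data Z n ω i)) atTop (fun _ => ∫ z, f z ∂P)

variable {w : (n : ℕ) → Ω → Fin n → ℝ}

/-- The weighted law of large numbers in each coordinate, the expected score at `θ₀` being zero. -/
lemma WeightedLLN.weightedScore_tendsto (hw : WeightedLLN μ P Z w)
    (hm : ConcaveTarget P Θ m) (hθ₀ : IsTrueParameter P Θ m θ₀) (hHess : HessianRegular P Θ m)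
    (hScore : ScoreRegular P Θ m) :
    TendstoInMeasure μ (fun n ω => ‖weightedScore Θ m (w n ω) (data Z n ω) θ₀‖) atTop
      (fun _ => 0) := by
  have hΘ := interior_subset hθ₀.mem_interior
  refine tendstoInMeasure_zero_of_abs_le
    (Y := fun n ω => ∑ k, |∑ i, w n ω i * gradientWithin (m (data Z n ω i)) Θ θ₀ k|) ?_ ?_
  · refine tendstoInMeasure_zero_sum _ fun k _ => ?_
    have h := hw.tendsto _ (hScore.sq_integrable θ₀ hΘ k)
    have h0 : ∫ z, gradientWithin (m z) Θ θ₀ k ∂P = 0 := by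
      have := (EuclideanSpace.proj k : EuclideanSpace ℝ (Fin d) →L[ℝ] ℝ).integral_comp_comm
        (hScore.integrable hΘ)
      rw [hθ₀.integral_gradient_eq_zero hm hHess hScore] at this
      simpa using this
    rw [h0] at h
    exact tendstoInMeasure_zero_of_abs_le h (Eventually.of_forall fun n ω => (abs_abs _).le)
  · refine Eventually.of_forall fun n ω => ?_
    rw [abs_norm]
    refine (norm_le_sum_abs_apply _).trans (le_trans (le_of_eq ?_) (le_abs_self _))
    refine Finset.sum_congr rfl fun k _ => ?_
    simp [weightedScore]

lemma WeightedLLN.hessianOp_tendsto (hw : WeightedLLN μ P Z w)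
    (hm : ConcaveTarget P Θ m) (hθ₀ : θ₀ ∈ interior Θ) (hHess : HessianRegular P Θ m)
    (hScore : ScoreRegular P Θ m) :
    TendstoInMeasure μ (fun n ω => ‖∑ i, w n ω i • hessianOp Θ (m (data Z n ω i)) θ₀ -
      hessianOp Θ (popTarget P m) θ₀‖) atTop (fun _ => 0) := by
  have hΘ := interior_subset hθ₀
  refine tendstoInMeasure_zero_of_abs_le
    (Y := fun n ω => ∑ k, ∑ l, |∑ i, w n ω i * hessian Θ (m (data Z n ω i)) θ₀ k l -
      expectedHessian P Θ m θ₀ k l|) ?_ ?_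
  · refine tendstoInMeasure_zero_sum _ fun k _ => tendstoInMeasure_zero_sum _ fun l _ => ?_
    exact tendstoInMeasure_zero_of_abs_le
      (tendstoInMeasure_sub_const (hw.tendsto _ (hHess.sq_integrable θ₀ hΘ k l)))
      (Eventually.of_forall fun n ω => (abs_abs _).le)
  · refine Eventually.of_forall fun n ω => ?_
    rw [abs_norm]
    refine (norm_le_sum_abs_entries _).trans (le_trans (le_of_eq ?_) (le_abs_self _))
    refine Finset.sum_congr rfl fun k _ => Finset.sum_congr rfl fun l _ => ?_
    rw [← hessian_popTarget hm hHess hScore hθ₀, ← hessianOp_single]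
    simp [hessianOp_single]

/-- Linearization of maximizers of weighted targets, with probability tending to one. -/
lemma WeightedLLN.linearization (hw : WeightedLLN μ P Z w) (hm : ConcaveTarget P Θ m)
    (hθ₀ : IsTrueParameter P Θ m θ₀) (hHess : HessianRegular P Θ m)
    (hScore : ScoreRegular P Θ m) {θn : ℕ → Ω → EuclideanSpace ℝ (Fin d)}
    (hmax : Tendsto (fun n => μ {ω | ¬ IsArgmax Θ
      (fun θ => ∑ i, w n ω i * m (data Z n ω i) θ) (θn n ω)}) atTop (𝓝 0)) :
    ∃ lam R : ℝ, 0 < lam ∧ 0 ≤ R ∧ ∀ ρ : ℝ, 0 < ρ → Tendsto (fun n => μ {ω |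
      ¬ (‖θn n ω - θ₀‖ ≤ 2 / lam * ‖weightedScore Θ m (w n ω) (data Z n ω) θ₀‖ ∧
        ‖weightedScore Θ m (w n ω) (data Z n ω) θ₀ +
          hessianOp Θ (popTarget P m) θ₀ (θn n ω - θ₀)‖ ≤
            (R * ‖θn n ω - θ₀‖ + ρ) * ‖θn n ω - θ₀‖)}) atTop (𝓝 0) := by
  have hΘ := interior_subset hθ₀.mem_interior
  have hconv : Convex ℝ Θ := by
    obtain ⟨z⟩ := P.nonempty_of_neZero
    exact (hm.concave z).1
  obtain ⟨lam, hlam, hA⟩ := exists_inner_le_of_posDef_neg (hHess.posDef θ₀ hΘ)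
  rw [← hessian_popTarget hm hHess hScore hθ₀.mem_interior, toEuclideanCLM_hessian] at hA
  obtain ⟨ψ, hψ, hlip⟩ := hHess.lipschitz
  have hψn := hw.tendsto _ hψ.abs
  set I : ℝ := ∫ z, |ψ| z ∂P with hI
  have hI0 : 0 ≤ I := integral_nonneg fun z => abs_nonneg _
  set R : ℝ := d ^ 2 * (I + 1) with hR
  have hR0 : 0 ≤ R := by positivity
  obtain ⟨r₁, hr₁, hr₁sub⟩ := Metric.nhds_basis_closedBall.mem_iff.mp
    (isOpen_interior.mem_nhds hθ₀.mem_interior)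
  -- The radius keeps the ball in the interior and `R r ≤ lam/4`. The `I + 1` in `R` leaves room for
  -- the fluctuation of the weighted average of `|ψ|` around its mean `I`.
  set r := min r₁ (lam / 4 / (R + 1)) with hr
  have hr0 : 0 < r := lt_min hr₁ (by positivity)
  have hrsub : Metric.closedBall θ₀ r ⊆ interior Θ :=
    (Metric.closedBall_subset_closedBall (min_le_left _ _)).trans hr₁sub
  have hRr : R * r ≤ lam / 4 := by
    have h1 : r ≤ lam / 4 / (R + 1) := min_le_right _ _
    rw [le_div_iff₀ (by positivity)] at h1
    nlinarith
  refine ⟨lam, R, hlam, hR0, fun ρ hρ => ?_⟩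
  have h1 := tendstoInMeasure_zero_iff.mp
    (hw.hessianOp_tendsto hm hθ₀.mem_interior hHess hScore) (min ρ (lam / 4)) (by positivity)
  have h2 := tendstoInMeasure_zero_iff.mp (tendstoInMeasure_sub_const hψn) 1 one_pos
  have h3 := tendstoInMeasure_zero_iff.mp (hw.weightedScore_tendsto hm hθ₀ hHess hScore)
    (lam * r / 2) (by positivity)
  have h4 := ((hmax.add h1).add h2).add h3
  simp only [add_zero] at h4
  refine tendsto_of_tendsto_of_tendsto_of_le_of_le' tendsto_const_nhds h4
    (Eventually.of_forall fun _ => zero_le) ?_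
  filter_upwards [hw.nonneg] with n hn
  refine le_trans (measure_mono ?_) ((measure_union_le _ _).trans (add_le_add_left
    ((measure_union_le _ _).trans (add_le_add_left (measure_union_le _ _) _)) _))
  intro ω hω
  by_contra hc
  simp only [Set.mem_union, not_or, Set.mem_ofPred_eq, not_not, not_le, abs_norm] at hc hω
  obtain ⟨⟨⟨c1, c2⟩, c3⟩, c4⟩ := hc
  refine hω ?_
  have hΨ : ∑ i, w n ω i * |ψ (data Z n ω i)| ≤ I + 1 := by
    have := (abs_lt.mp c3).2
    simp only [Pi.abs_apply] at this
    linarith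
  have hΨR : d ^ 2 * (∑ i, w n ω i * |ψ (data Z n ω i)|) ≤ R := by
    rw [hR]; gcongr
  have key := norm_argmax_sub_le (w := w n ω) (ψ := fun i => ψ (data Z n ω i))
    (f := fun i => m (data Z n ω i)) (hn ω) (fun i => hm.concave _) hconv
    (fun i => hHess.differentiable _) (fun i => hHess.differentiable_grad _)
    (fun i => hlip (data Z n ω i)) hrsub hr0 hlam hA c2.le (min_le_right _ _)
    ((mul_le_mul_of_nonneg_right hΨR hr0.le).trans hRr)
    (by change 2 * ‖weightedScore Θ m (w n ω) (data Z n ω) θ₀‖ < _; linarith) c1.1 c1.2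
  refine ⟨key.1, key.2.trans ?_⟩
  gcongr
  exact min_le_left _ _

/-- Consistency of maximizers of weighted targets. -/
lemma WeightedLLN.consistency (hw : WeightedLLN μ P Z w) (hm : ConcaveTarget P Θ m)
    (hθ₀ : IsTrueParameter P Θ m θ₀) (hHess : HessianRegular P Θ m)
    (hScore : ScoreRegular P Θ m) {θn : ℕ → Ω → EuclideanSpace ℝ (Fin d)}
    (hmax : Tendsto (fun n => μ {ω | ¬ IsArgmax Θ
      (fun θ => ∑ i, w n ω i * m (data Z n ω i) θ) (θn n ω)}) atTop (𝓝 0)) :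
    TendstoInMeasure μ (fun n ω => ‖θn n ω - θ₀‖) atTop (fun _ => 0) := by
  obtain ⟨lam, R, hlam, -, h⟩ := hw.linearization hm hθ₀ hHess hScore hmax
  rw [tendstoInMeasure_zero_iff]
  intro ε hε
  have h1 := tendstoInMeasure_zero_iff.mp (tendstoInMeasure_zero_const_mul
    (hw.weightedScore_tendsto hm hθ₀ hHess hScore) (2 / lam)) ε hε
  -- The value of `ρ` is immaterial: only the bound by the score is used.
  have h2 := (h 1 one_pos).add h1
  rw [add_zero] at h2
  refine tendsto_of_tendsto_of_tendsto_of_le_of_le tendsto_const_nhds h2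
    (fun _ => zero_le) fun n => le_trans (measure_mono ?_) (measure_union_le _ _)
  intro ω hω
  by_contra hc
  simp only [Set.mem_union, not_or, Set.mem_ofPred_eq, not_not, not_le, abs_norm] at hc hω
  have := (le_abs_self _).trans_lt hc.2
  linarith [hc.1.1]

variable [IsProbabilityMeasure μ]

/-- Makes the general consistency result available for the full data estimator. -/
lemma IsSamplingScheme.weightedLLN_full (h : IsSamplingScheme μ P Z U) :
    WeightedLLN μ P Z (fun n _ _ => 1 / (n : ℝ)) where
  nonneg := Eventually.of_forall fun n ω i => by positivity
  tendsto f hf := by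
    simp_rw [← Finset.mul_sum]
    exact h.tendstoInMeasure_average (hf.integrable one_le_two)

/-- The fourth moments of the scores at the true parameter are bounded in probability. -/
lemma IsSamplingScheme.boundedInProb_scoreFourth (h : IsSamplingScheme μ P Z U)
    (hm : ConcaveTarget P Θ m) (hθ₀ : IsTrueParameter P Θ m θ₀) (hHess : HessianRegular P Θ m)
    (hScore : ScoreRegular P Θ m) {θhat : ℕ → Ω → EuclideanSpace ℝ (Fin d)}
    (hθhat : ∀ n, ∀ᵐ ω ∂μ, IsArgmax Θ (fullTarget m (data Z n ω)) (θhat n ω))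
    (hFourth : ∃ δ : ℝ, 0 < δ ∧ ∀ θ ∈ Θ, BoundedInProb μ fun n =>
      {ω | dist θ (θhat n ω) < δ}.indicator fun ω => scoreFourth Θ m (data Z n ω) θ) :
    BoundedInProb μ (fun n ω => scoreFourth Θ m (data Z n ω) θ₀) := by
  have hcons := h.weightedLLN_full.consistency hm hθ₀ hHess hScore (θn := θhat) (by
    have : ∀ n : ℕ, μ {ω | ¬ IsArgmax Θ
        (fun θ => ∑ i, 1 / (n : ℝ) * m (data Z n ω i) θ) (θhat n ω)} = 0 := by
      intro n
      have e : ∀ ω, (fun θ => ∑ i, 1 / (n : ℝ) * m (data Z n ω i) θ) =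
          fullTarget m (data Z n ω) := fun ω => by
        ext θ
        rw [fullTarget, Finset.mul_sum]
      simp_rw [e]
      exact ae_iff.mp (hθhat n)
    simp only [this]
    exact tendsto_const_nhds)
  obtain ⟨δ, hδ, hb⟩ := hFourth
  intro ε hε
  obtain ⟨K, hK⟩ := hb θ₀ (interior_subset hθ₀.mem_interior) (ε / 2) (half_pos hε)
  refine ⟨K, ?_⟩
  filter_upwards [hK, eventually_measure_le_of_tendstoInMeasure hcons hδ (half_pos hε)]
    with n h1 h2
  calc _ ≤ μ (_ ∪ _) := measure_mono fun ω hω => ?_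
    _ ≤ _ := measure_union_le _ _
    _ ≤ _ := add_le_add h1 h2
    _ = _ := by rw [← ENNReal.ofReal_add (by positivity) (by positivity), add_halves]
  by_contra hc
  simp only [Set.mem_union, not_or, Set.mem_ofPred_eq, not_le, sub_zero, abs_norm] at hc hω
  refine hc.1 ?_
  -- Once `θhat` is within `δ` of `θ₀`, the indicator in the hypothesis is one.
  rw [Set.indicator_of_mem]
  · exact hω
  · rw [Set.mem_ofPred_eq, dist_comm, dist_eq_norm]; exact hc.2

end Linearization

/-! ### Inverse probability weights and the random subsample size. -/

section PoissonWeight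

variable {𝒵 Ω : Type*} {Z : ℕ → Ω → 𝒵} {U : (n : ℕ) → Fin n → Ω → ℝ}
  {s : ℕ → ℝ} {p : (n : ℕ) → (Fin n → 𝒵) → Fin n → ℝ}

/-- The inverse probability weights `1{u_i ≤ s π_i} / (n s π_i)`. -/
def poissonWeight (Z : ℕ → Ω → 𝒵) (U : (n : ℕ) → Fin n → Ω → ℝ) (s : ℕ → ℝ)
    (p : (n : ℕ) → (Fin n → 𝒵) → Fin n → ℝ) (n : ℕ) (ω : Ω) (i : Fin n) : ℝ :=
  1 / (n : ℝ) * (centeredInclusion (s n * p n (data Z n ω) i) (U n i ω) + 1)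

/-- Separates full data randomness from sampling randomness: when `0 < s_n π_i ≤ 1`, the first term
is the conditional mean given the data. -/
lemma sum_poissonWeight_mul (f : 𝒵 → ℝ) (n : ℕ) (ω : Ω) :
    ∑ i, poissonWeight Z U s p n ω i * f (data Z n ω i) =
      1 / (n : ℝ) * ∑ i, f (data Z n ω i) +
      inclusionSum Z U (fun n D i => f (D i) / n) (fun n D i => s n * p n D i) n ω := by
  simp only [inclusionSum, poissonWeight]
  rw [Finset.mul_sum, ← Finset.sum_add_distrib]
  exact Finset.sum_congr rfl fun i _ => by ring

lemma inv_le_iSup (n : ℕ) (D : Fin n → 𝒵) (i : Fin n) :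
    ((n : ℝ) * p n D i)⁻¹ ≤ ⨆ i : Fin n, ((n : ℝ) * p n D i)⁻¹ :=
  le_ciSup (f := fun i => ((n : ℝ) * p n D i)⁻¹) (Set.finite_range _).bddAbove i

end PoissonWeight

section Poisson

open scoped RealInnerProductSpace
open Complex (I)

variable {𝒵 Ω : Type*} [MeasurableSpace 𝒵] [MeasurableSpace Ω] {μ : Measure Ω}
  [IsProbabilityMeasure μ] {P : Measure 𝒵} {d : ℕ}
  {Θ : Set (EuclideanSpace ℝ (Fin d))} {m : 𝒵 → EuclideanSpace ℝ (Fin d) → ℝ}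
  {θ₀ : EuclideanSpace ℝ (Fin d)} {Z : ℕ → Ω → 𝒵} {U : (n : ℕ) → Fin n → Ω → ℝ}
  {s : ℕ → ℝ} {p : (n : ℕ) → (Fin n → 𝒵) → Fin n → ℝ}

lemma IsPoissonDistribution.eventually_mem_Ioc (hp : IsPoissonDistribution s p)
    (hs : Tendsto s atTop atTop) :
    ∀ᶠ n in atTop, ∀ D i, 0 < s n * p n D i ∧ s n * p n D i ≤ 1 := by
  filter_upwards [hs.eventually_gt_atTop 0] with n hn D i
  exact ⟨mul_pos hn (hp.pos n D i), hp.le_one n D i⟩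

/-- The sampling fluctuation has conditional variance at most `s_n⁻¹ · max (n π_i)⁻¹ · n⁻¹ ∑
f(Z_i)²`, that is, a null sequence times a quantity bounded in probability. -/
lemma IsSamplingScheme.weightedLLN_poisson [IsProbabilityMeasure P] (h : IsSamplingScheme μ P Z U)
    (hp : IsPoissonDistribution s p) (hs : Tendsto s atTop atTop)
    (hπ : BoundedInProb μ fun n ω => ⨆ i : Fin n, ((n : ℝ) * p n (data Z n ω) i)⁻¹) :
    WeightedLLN μ P Z (poissonWeight Z U s p) where
  nonneg := by
    filter_upwards [hp.eventually_mem_Ioc hs] with n hn ω i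
    have := (hn (data Z n ω) i).1
    refine mul_nonneg (by positivity) ?_
    rw [centeredInclusion, sub_add_cancel]
    split_ifs <;> positivity
  tendsto f hf := by
    have hsq : BoundedInProb μ (fun (n : ℕ) ω => 1 / (n : ℝ) * ∑ i, f (data Z n ω i) ^ 2) :=
      BoundedInProb.of_tendstoInMeasure (h.tendstoInMeasure_average (f := fun z => f z ^ 2)
        hf.integrable_sq)
    have hinc := h.tendstoInMeasure_inclusionSum (c := fun n D i => f (D i) / n)
      (q := fun n D i => s n * p n D i)
      (fun n i => (h.aemeasurable_comp_eval i hf.aestronglyMeasurable.aemeasurable).div_const _)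
      (fun n i => (hp.measurable n i).const_mul _) (hp.eventually_mem_Ioc hs)
      (tendstoInMeasure_zero_of_abs_le ((hπ.mul hsq).mul_tendsto_zero
        (tendsto_inv_atTop_zero.comp hs)) (by
          filter_upwards [hs.eventually_gt_atTop 0, eventually_gt_atTop 0] with n hn hn0 ω
          have hn0' : (0 : ℝ) < n := by exact_mod_cast hn0
          rw [abs_of_nonneg (Finset.sum_nonneg fun i _ => div_nonneg (sq_nonneg _)
            (mul_pos hn (hp.pos n _ i)).le)]
          refine le_trans ?_ (le_abs_self _)
          simp only [Function.comp_apply]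
          rw [Finset.mul_sum, Finset.mul_sum, Finset.mul_sum]
          refine Finset.sum_le_sum fun i _ => ?_
          have hpi := hp.pos n (data Z n ω) i
          calc (f (data Z n ω i) / n) ^ 2 / (s n * p n (data Z n ω) i) =
              (s n)⁻¹ * (((n : ℝ) * p n (data Z n ω) i)⁻¹ *
                (1 / (n : ℝ) * f (data Z n ω i) ^ 2)) := by field_simp
            _ ≤ _ := by
              gcongr
              exact inv_le_iSup n (data Z n ω) i))
    have hav := tendstoInMeasure_sub_const (h.tendstoInMeasure_average (hf.integrable one_le_two))
    have := tendstoInMeasure_zero_add hav hinc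
    rw [tendstoInMeasure_iff_norm]
    intro ε hε
    have h2 := tendstoInMeasure_zero_iff.mp this ε hε
    refine h2.congr fun n => ?_
    congr 1
    ext ω
    simp only [Set.mem_ofPred_eq, Real.norm_eq_abs]
    rw [sum_poissonWeight_mul]
    ring_nf

/-- With probability tending to one, maximizing the Poisson subsample target amounts to maximizing
the target with inverse probability weights. -/
lemma IsSamplingScheme.tendsto_measure_not_isArgmax (h : IsSamplingScheme μ P Z U)
    (hp : IsPoissonDistribution s p) (hs : Tendsto s atTop atTop)
    {θtilde : ℕ → Ω → EuclideanSpace ℝ (Fin d)}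
    (hθtilde : ∀ n, ∀ᵐ ω ∂μ, IsArgmax Θ
      (poissonTarget m (s n) (p n (data Z n ω)) (fun i => U n i ω) (data Z n ω)) (θtilde n ω)) :
    Tendsto (fun n => μ {ω | ¬ IsArgmax Θ
      (fun θ => ∑ i, poissonWeight Z U s p n ω i * m (data Z n ω i) θ) (θtilde n ω)}) atTop
      (𝓝 0) := by
  -- For `c = p` the centred sum is `s*/s_n - 1`, with `∑ c_i²/q_i = 1/s_n`. It equals `-1` on an
  -- empty subsample, so that event has vanishing probability.
  have hinc := h.tendstoInMeasure_inclusionSum (c := p)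
    (q := fun n D i => s n * p n D i) (fun n i => (hp.measurable n i).aemeasurable)
    (fun n i => (hp.measurable n i).const_mul _) (hp.eventually_mem_Ioc hs) (by
      have h1 : BoundedInProb μ (fun _ _ => (1 : ℝ)) := fun ε hε => ⟨1, by simp⟩
      refine tendstoInMeasure_zero_of_abs_le (h1.mul_tendsto_zero
        (tendsto_inv_atTop_zero.comp hs)) ?_
      filter_upwards [hs.eventually_gt_atTop 0, eventually_ge_atTop 1] with n hn hn0 ω
      refine le_of_eq ?_
      congr 1
      have e : ∀ i, p n (data Z n ω) i ^ 2 / (s n * p n (data Z n ω) i) =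
          (s n)⁻¹ * p n (data Z n ω) i := fun i => by
        have := (hp.pos n (data Z n ω) i).ne'
        field_simp
      simp_rw [e]
      rw [← Finset.mul_sum, hp.sum_eq_one n hn0]
      rfl)
  have h1 := tendstoInMeasure_zero_iff.mp hinc 1 one_pos
  refine tendsto_of_tendsto_of_tendsto_of_le_of_le' tendsto_const_nhds h1
    (Eventually.of_forall fun _ => zero_le) ?_
  filter_upwards [hs.eventually_gt_atTop 0, eventually_ge_atTop 1] with n hn hn0
  refine measure_mono_ae ?_
  filter_upwards [hθtilde n] with ω hω hnot
  change 1 ≤ |_|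
  by_contra hlt
  refine hnot ⟨hω.1, ?_⟩
  set S := poissonSample (s n) (p n (data Z n ω)) (fun i => U n i ω) with hS
  have hcard : 0 < (S.card : ℝ) := by
    rw [Nat.cast_pos, Finset.card_pos]
    by_contra hne
    rw [Finset.not_nonempty_iff_eq_empty] at hne
    refine hlt ?_
    have hout : ∀ i, ¬ U n i ω ≤ s n * p n (data Z n ω) i := by
      intro i hi
      have : i ∈ S := by rw [hS, poissonSample]; simpa using hi
      rw [hne] at this
      simp at this
    have : inclusionSum Z U p (fun n D i => s n * p n D i) n ω = -1 := by
      simp only [inclusionSum, centeredInclusion, hout, if_false, zero_sub, mul_neg, mul_one]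
      rw [Finset.sum_neg_distrib, hp.sum_eq_one n hn0]
    rw [this]; simp
  have e : ∀ θ, ∑ i, poissonWeight Z U s p n ω i * m (data Z n ω i) θ =
      S.card / s n * poissonTarget m (s n) (p n (data Z n ω)) (fun i => U n i ω)
        (data Z n ω) θ := by
    intro θ
    rw [poissonTarget, ← hS, Finset.mul_sum, hS, poissonSample, Finset.sum_filter]
    refine Finset.sum_congr rfl fun i _ => ?_
    have hpi := (hp.pos n (data Z n ω) i).ne'
    rw [← poissonSample, ← hS, poissonWeight, centeredInclusion, sub_add_cancel]
    split_ifs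
    · field_simp
    · simp
  intro θ hθ
  change (∑ i, poissonWeight Z U s p n ω i * m (data Z n ω i) θ) ≤
    ∑ i, poissonWeight Z U s p n ω i * m (data Z n ω i) (θtilde n ω)
  rw [e, e]
  exact mul_le_mul_of_nonneg_left (hω.2 hθ) (by positivity)

end Poisson

/-! ### Central limit theorem for the weighted score. -/

section ScoreQuadratic

open scoped RealInnerProductSpace Matrix

variable {𝒵 : Type*} {d : ℕ} {Θ : Set (EuclideanSpace ℝ (Fin d))}
  {m : 𝒵 → EuclideanSpace ℝ (Fin d) → ℝ} {θ₀ : EuclideanSpace ℝ (Fin d)}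

lemma inner_eq_sum (u v : EuclideanSpace ℝ (Fin d)) : ⟪u, v⟫ = ∑ k, u k * v k := by
  simp [PiLp.inner_apply, mul_comm]

lemma sum_inner_sq_div_eq {n : ℕ} (q : Fin n → ℝ) (D : Fin n → 𝒵)
    (u : EuclideanSpace ℝ (Fin d)) :
    1 / (n : ℝ) ^ 2 * ∑ i, ⟪u, gradientWithin (m (D i)) Θ θ₀⟫ ^ 2 / q i =
      ∑ k, ∑ l, u k * u l * lambdaR Θ m q D θ₀ k l := by
  simp only [lambdaR, Matrix.smul_apply, Matrix.sum_apply, smul_eq_mul, outer, Matrix.of_apply]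
  have : ∀ i, ⟪u, gradientWithin (m (D i)) Θ θ₀⟫ ^ 2 / q i = ∑ k, ∑ l, u k * u l *
      (1 / q i * (gradientWithin (m (D i)) Θ θ₀ k * gradientWithin (m (D i)) Θ θ₀ l)) := by
    intro i
    rw [inner_eq_sum, sq, Finset.sum_mul_sum, Finset.sum_div]
    refine Finset.sum_congr rfl fun k _ => ?_
    rw [Finset.sum_div]
    exact Finset.sum_congr rfl fun l _ => by ring
  simp_rw [this]
  rw [Finset.sum_comm, Finset.mul_sum]
  refine Finset.sum_congr rfl fun k _ => ?_
  rw [Finset.sum_comm, Finset.mul_sum]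
  refine Finset.sum_congr rfl fun l _ => ?_
  rw [← Finset.mul_sum]
  ring

variable {Ω : Type*} [MeasurableSpace Ω] {μ : Measure Ω} {Z : ℕ → Ω → 𝒵}
  {p : (n : ℕ) → (Fin n → 𝒵) → Fin n → ℝ}

lemma tendstoInMeasure_sum_inner_sq {Λπ : Matrix (Fin d) (Fin d) ℝ}
    (hΛ : ∀ k l, TendstoInMeasure μ
      (fun n ω => lambdaR Θ m (p n (data Z n ω)) (data Z n ω) θ₀ k l) atTop (fun _ => Λπ k l))
    (u : EuclideanSpace ℝ (Fin d)) :
    TendstoInMeasure μ (fun (n : ℕ) ω => 1 / (n : ℝ) ^ 2 *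
      ∑ i, ⟪u, gradientWithin (m (data Z n ω i)) Θ θ₀⟫ ^ 2 / p n (data Z n ω) i -
        u.ofLp ⬝ᵥ Λπ *ᵥ u.ofLp) atTop (fun _ => 0) := by
  have h : TendstoInMeasure μ (fun n ω => ∑ k, ∑ l, u k * u l *
      (lambdaR Θ m (p n (data Z n ω)) (data Z n ω) θ₀ k l - Λπ k l)) atTop (fun _ => 0) :=
    tendstoInMeasure_zero_sum _ fun k _ => tendstoInMeasure_zero_sum _ fun l _ =>
      tendstoInMeasure_zero_const_mul (tendstoInMeasure_sub_const (hΛ k l)) _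
  refine tendstoInMeasure_zero_of_abs_le h (Eventually.of_forall fun n ω => le_of_eq ?_)
  congr 1
  rw [sum_inner_sq_div_eq]
  simp only [dotProduct, Matrix.mulVec, Finset.mul_sum]
  rw [← Finset.sum_sub_distrib]
  refine Finset.sum_congr rfl fun k _ => ?_
  rw [← Finset.sum_sub_distrib]
  exact Finset.sum_congr rfl fun l _ => by ring

end ScoreQuadratic

section PoissonCLT

open scoped RealInnerProductSpace Matrix
open Complex (I ofReal_mul norm_real ofReal_sub)

variable {𝒵 Ω : Type*} [MeasurableSpace 𝒵] [MeasurableSpace Ω] {μ : Measure Ω}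
  {P : Measure 𝒵} {d : ℕ}
  {Θ : Set (EuclideanSpace ℝ (Fin d))} {m : 𝒵 → EuclideanSpace ℝ (Fin d) → ℝ}
  {θ₀ : EuclideanSpace ℝ (Fin d)} {Z : ℕ → Ω → 𝒵} {U : (n : ℕ) → Fin n → Ω → ℝ}
  {s : ℕ → ℝ} {p : (n : ℕ) → (Fin n → 𝒵) → Fin n → ℝ}

lemma IsSamplingScheme.aemeasurable_weightedScore [IsProbabilityMeasure P]
    (h : IsSamplingScheme μ P Z U)
    (hp : IsPoissonDistribution s p) (hScore : ScoreRegular P Θ m)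
    {θ : EuclideanSpace ℝ (Fin d)} (hθ : θ ∈ Θ) (n : ℕ) :
    AEMeasurable (fun ω => weightedScore Θ m (poissonWeight Z U s p n ω) (data Z n ω) θ) μ := by
  refine Finset.aemeasurable_fun_sum _ fun i _ => AEMeasurable.fun_smul ?_ ?_
  · refine AEMeasurable.const_mul (AEMeasurable.add_const ?_ 1) _
    exact measurable_centeredInclusion.comp_aemeasurable
      ((((hp.measurable n i).const_mul _).comp_aemeasurable (h.aemeasurable_data n)).prodMk
        (h.law_unif n i).aemeasurable)
  · exact (h.aemeasurable_comp_eval i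
      (hScore.integrable hθ).aestronglyMeasurable.aemeasurable).comp_aemeasurable
        (h.aemeasurable_data n)

variable [IsProbabilityMeasure μ] [IsProbabilityMeasure P]

/-- The characteristic function of the normalized inverse probability weighted score converges to
that of a Gaussian law. -/
lemma IsSamplingScheme.tendsto_integral_exp_inner_weightedScore (h : IsSamplingScheme μ P Z U)
    (hs : Tendsto s atTop atTop) (hsn : ∀ᶠ n : ℕ in atTop, s n < n)
    (hp : IsPoissonDistribution s p)
    (hm : ConcaveTarget P Θ m) (hθ₀ : IsTrueParameter P Θ m θ₀) (hHess : HessianRegular P Θ m)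
    (hScore : ScoreRegular P Θ m)
    (hF : BoundedInProb μ (fun n ω => scoreFourth Θ m (data Z n ω) θ₀))
    (hπ : BoundedInProb μ fun n ω => ⨆ i : Fin n, ((n : ℝ) * p n (data Z n ω) i)⁻¹)
    {Λπ : Matrix (Fin d) (Fin d) ℝ}
    (hΛ : ∀ k l, TendstoInMeasure μ
      (fun n ω => lambdaR Θ m (p n (data Z n ω)) (data Z n ω) θ₀ k l) atTop (fun _ => Λπ k l))
    (u : EuclideanSpace ℝ (Fin d)) :
    Tendsto (fun n => ∫ ω, Complex.exp ((√(s n) * ⟪u, weightedScore Θ m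
      (poissonWeight Z U s p n ω) (data Z n ω) θ₀⟫ : ℝ) * I) ∂μ) atTop
      (𝓝 (Real.exp (-((u.ofLp ⬝ᵥ Λπ *ᵥ u.ofLp) / 2)) : ℝ)) := by
  have hΘ := interior_subset hθ₀.mem_interior
  set x : 𝒵 → ℝ := fun z => ⟪u, gradientWithin (m z) Θ θ₀⟫ with hx
  set v : ℝ := u.ofLp ⬝ᵥ Λπ *ᵥ u.ofLp with hv
  set σ : ℝ := ∫ z, x z ^ 2 ∂P with hσ
  have hσ0 : 0 ≤ σ := integral_nonneg fun z => sq_nonneg _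
  have hx2 : MemLp x 2 P := (innerSL ℝ u).comp_memLp'
    (memLp_of_forall_apply (hScore.sq_integrable θ₀ hΘ))
  have hx0 : ∫ z, x z ∂P = 0 := by
    have := (innerSL ℝ u).integral_comp_comm (hScore.integrable hΘ)
    rw [hθ₀.integral_gradient_eq_zero hm hHess hScore, map_zero] at this
    exact this
  have hxm := hx2.aestronglyMeasurable.aemeasurable
  set c : (n : ℕ) → (Fin n → 𝒵) → Fin n → ℝ := fun n D i => √(s n) * x (D i) / n with hc
  set q : (n : ℕ) → (Fin n → 𝒵) → Fin n → ℝ := fun n D i => s n * p n D i with hq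
  set a : ℕ → ℝ := fun n => √(s n) / √n with ha
  set b : (n : ℕ) → (Fin n → 𝒵) → ℝ := fun n D => a n / √n * ∑ i, x (D i) with hb
  -- The conditional variance is `uᵀ Λ_{n,R} u` minus `s_n/n` times the average of the `x(Z_i)²`;
  -- `τ` is its deterministic approximation.
  set τ : ℕ → ℝ := fun n => v - s n / n * σ with hτ
  have hev : ∀ᶠ n : ℕ in atTop, 0 < s n ∧ s n < n ∧ (0 : ℝ) < n := by
    filter_upwards [hs.eventually_gt_atTop 0, hsn] with n h1 h2
    exact ⟨h1, h2, h1.trans h2⟩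
  have hratio : ∀ᶠ n : ℕ in atTop, 0 ≤ s n / n ∧ s n / n ≤ 1 := by
    filter_upwards [hev] with n ⟨h1, h2, h3⟩
    exact ⟨by positivity, (div_le_one h3).mpr h2.le⟩
  have ha2 : ∀ᶠ n : ℕ in atTop, a n ^ 2 = s n / n := by
    filter_upwards [hev] with n ⟨h1, h2, h3⟩
    simp only [ha]
    rw [div_pow, Real.sq_sqrt h1.le, Real.sq_sqrt h3.le]
  have ha1 : ∀ᶠ n : ℕ in atTop, |a n| ≤ 1 := by
    filter_upwards [ha2, hratio] with n h1 h2
    rw [← sq_le_one_iff_abs_le_one, h1]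
    exact h2.2
  have hq01 := hp.eventually_mem_Ioc hs
  have hxn : ∀ z, |x z| ≤ ‖u‖ * ‖gradientWithin (m z) Θ θ₀‖ := fun z =>
    abs_real_inner_le_norm _ _
  have hB := hπ.mul hπ
  have h4 : TendstoInMeasure μ
      (fun n ω => ∑ i, c n (data Z n ω) i ^ 4 / q n (data Z n ω) i ^ 2) atTop (fun _ => 0) := by
    refine tendstoInMeasure_zero_of_abs_le (tendstoInMeasure_zero_const_mul
      ((hB.mul hF).mul_tendsto_zero (a := fun n : ℕ => (n : ℝ)⁻¹)
        (tendsto_inv_atTop_zero.comp tendsto_natCast_atTop_atTop)) (‖u‖ ^ 4)) ?_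
    filter_upwards [hev] with n ⟨h1, h2, h3⟩ ω
    rw [abs_of_nonneg (Finset.sum_nonneg fun i _ => by positivity)]
    refine le_trans ?_ (le_abs_self _)
    set B := ⨆ i : Fin n, ((n : ℝ) * p n (data Z n ω) i)⁻¹
    have hBi : ∀ i, ((n : ℝ) * p n (data Z n ω) i)⁻¹ ≤ B := inv_le_iSup n (data Z n ω)
    simp only [scoreFourth, Finset.mul_sum]
    refine Finset.sum_le_sum fun i _ => ?_
    have hpi := hp.pos n (data Z n ω) i
    have hB0 : 0 ≤ B := le_trans (by positivity) (hBi i)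
    have hx4 : x (data Z n ω i) ^ 4 ≤
        ‖u‖ ^ 4 * ‖gradientWithin (m (data Z n ω i)) Θ θ₀‖ ^ 4 := by
      rw [← mul_pow, ← Even.pow_abs (by decide : Even 4)]
      exact pow_le_pow_left₀ (abs_nonneg _) (hxn _) 4
    have hs4 : √(s n) ^ 4 = s n ^ 2 := by
      rw [show (4 : ℕ) = 2 * 2 from rfl, pow_mul, Real.sq_sqrt h1.le]
    calc c n (data Z n ω) i ^ 4 / q n (data Z n ω) i ^ 2 =
        (n : ℝ)⁻¹ * (((n : ℝ) * p n (data Z n ω) i)⁻¹ * ((n : ℝ) * p n (data Z n ω) i)⁻¹ *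
          (1 / (n : ℝ) * x (data Z n ω i) ^ 4)) := by
          simp only [hc, hq]
          rw [div_pow, mul_pow, hs4]
          field_simp
      _ ≤ (n : ℝ)⁻¹ * (B * B * (1 / (n : ℝ) *
          (‖u‖ ^ 4 * ‖gradientWithin (m (data Z n ω i)) Θ θ₀‖ ^ 4))) := by
          gcongr
          · exact hBi i
          · exact hBi i
      _ = _ := by ring
  have h3 : TendstoInMeasure μ
      (fun n ω => ∑ i, |c n (data Z n ω) i| ^ 3 / q n (data Z n ω) i ^ 2) atTop
        (fun _ => 0) := by
    refine tendstoInMeasure_zero_of_abs_le (tendstoInMeasure_zero_const_mul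
      ((hB.mul hF.one_add).mul_tendsto_zero (a := fun n : ℕ => (√(s n))⁻¹)
        (tendsto_inv_atTop_zero.comp (Real.tendsto_sqrt_atTop.comp hs))) (‖u‖ ^ 3)) ?_
    filter_upwards [hev] with n ⟨h1, h2, h3⟩ ω
    rw [abs_of_nonneg (Finset.sum_nonneg fun i _ => by positivity)]
    refine le_trans ?_ (le_abs_self _)
    set B := ⨆ i : Fin n, ((n : ℝ) * p n (data Z n ω) i)⁻¹
    have hBi : ∀ i, ((n : ℝ) * p n (data Z n ω) i)⁻¹ ≤ B := inv_le_iSup n (data Z n ω)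
    -- Third moments are controlled by fourth ones through `G³ ≤ 1 + G⁴`.
    have hone : 1 + scoreFourth Θ m (data Z n ω) θ₀ =
        ∑ i, 1 / (n : ℝ) * (1 + ‖gradientWithin (m (data Z n ω i)) Θ θ₀‖ ^ 4) := by
      rw [scoreFourth, ← Finset.mul_sum, Finset.sum_add_distrib, mul_add]
      simp [h3.ne']
    rw [hone]
    simp only [Finset.mul_sum]
    refine Finset.sum_le_sum fun i _ => ?_
    have hpi := hp.pos n (data Z n ω) i
    have hB0 : 0 ≤ B := le_trans (by positivity) (hBi i)
    set G := ‖gradientWithin (m (data Z n ω i)) Θ θ₀‖ with hG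
    have hG0 : 0 ≤ G := norm_nonneg _
    have hx3 : |x (data Z n ω i)| ^ 3 ≤ ‖u‖ ^ 3 * (1 + G ^ 4) := by
      refine (pow_le_pow_left₀ (abs_nonneg _) (hxn _) 3).trans ?_
      rw [mul_pow]
      gcongr
      rcases le_total G 1 with hG1 | hG1
      · have := pow_le_one₀ hG0 hG1 (n := 3)
        have := pow_nonneg hG0 4
        linarith
      · have := pow_le_pow_right₀ hG1 (show 3 ≤ 4 by norm_num)
        linarith
    have hsq : √(s n) ^ 2 = s n := Real.sq_sqrt h1.le
    have hsp : 0 < √(s n) := Real.sqrt_pos.mpr h1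
    calc |c n (data Z n ω) i| ^ 3 / q n (data Z n ω) i ^ 2 =
        (√(s n))⁻¹ * (((n : ℝ) * p n (data Z n ω) i)⁻¹ * ((n : ℝ) * p n (data Z n ω) i)⁻¹ *
          (1 / (n : ℝ) * |x (data Z n ω i)| ^ 3)) := by
          simp only [hc, hq]
          rw [abs_div, abs_mul, abs_of_pos hsp, abs_of_pos h3, ← hsq]
          rw [Real.sqrt_sq hsp.le]
          field_simp
      _ ≤ (√(s n))⁻¹ * (B * B * (1 / (n : ℝ) * (‖u‖ ^ 3 * (1 + G ^ 4)))) := by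
          gcongr
          · exact hBi i
          · exact hBi i
      _ = _ := by ring
  have hvar : TendstoInMeasure μ (fun n ω => ∑ i, c n (data Z n ω) i ^ 2 *
      (1 / q n (data Z n ω) i - 1) - τ n) atTop (fun _ => 0) := by
    have hsqav := tendstoInMeasure_sub_const (h.tendstoInMeasure_average
      (f := fun z => x z ^ 2) hx2.integrable_sq)
    have hsqav' : TendstoInMeasure μ (fun (n : ℕ) ω => s n / n * (1 / (n : ℝ) *
        ∑ i, x (data Z n ω i) ^ 2 - σ)) atTop (fun _ => 0) := by
      refine tendstoInMeasure_zero_of_abs_le hsqav ?_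
      filter_upwards [hratio] with n hn ω
      rw [abs_mul, abs_of_nonneg hn.1]
      exact mul_le_of_le_one_left (abs_nonneg _) hn.2
    refine tendstoInMeasure_zero_of_abs_le (tendstoInMeasure_zero_add
      (tendstoInMeasure_sum_inner_sq hΛ u) (tendstoInMeasure_zero_const_mul hsqav' (-1))) ?_
    filter_upwards [hev] with n ⟨h1, h2, h3⟩ ω
    refine le_of_eq ?_
    congr 1
    have e : ∑ i, c n (data Z n ω) i ^ 2 * (1 / q n (data Z n ω) i - 1) =
        1 / (n : ℝ) ^ 2 * ∑ i, x (data Z n ω i) ^ 2 / p n (data Z n ω) i -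
          s n / n * (1 / (n : ℝ) * ∑ i, x (data Z n ω i) ^ 2) := by
      rw [Finset.mul_sum, Finset.mul_sum, Finset.mul_sum, ← Finset.sum_sub_distrib]
      refine Finset.sum_congr rfl fun i _ => ?_
      have hpi := (hp.pos n (data Z n ω) i).ne'
      simp only [hc, hq]
      rw [div_pow, mul_pow, Real.sq_sqrt h1.le]
      field_simp
    rw [e]
    simp only [hτ, hx]
    ring
  have hmain := h.tendsto_integral_exp_sub (b := b) (c := c) (q := q) (τ := τ) (C := |v| + σ)
    (fun n => (Finset.aemeasurable_fun_sum _ fun i _ => h.aemeasurable_comp_eval i hxm).const_mul _)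
    (fun n i => ((h.aemeasurable_comp_eval i hxm).const_mul _).div_const _)
    (fun n i => (hp.measurable n i).const_mul _) hq01 h3 h4
    (by
      filter_upwards [hratio] with n hn
      have := mul_le_of_le_one_left hσ0 hn.2
      simp only [hτ]
      linarith [neg_abs_le v]) hvar
  have hiid := h.tendsto_integral_exp_average hx2 hx0 ha1
  have hprod : Tendsto (fun n => (∫ ω, Complex.exp (b n (data Z n ω) * I) ∂μ -
      (Real.exp (-(a n ^ 2 * σ / 2)) : ℝ)) * (Real.exp (-(τ n / 2)) : ℝ)) atTop (𝓝 0) := by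
    refine squeeze_zero_norm' (a := fun n => ‖∫ ω, Complex.exp (b n (data Z n ω) * I) ∂μ -
      (Real.exp (-(a n ^ 2 * σ / 2)) : ℝ)‖ * Real.exp ((|v| + σ) / 2)) ?_ ?_
    · filter_upwards [hratio] with n hn
      have := mul_le_of_le_one_left hσ0 hn.2
      rw [norm_mul, norm_real, Real.norm_of_nonneg (Real.exp_pos _).le]
      gcongr
      simp only [hτ]
      linarith [neg_abs_le v]
    · rw [← zero_mul (Real.exp ((|v| + σ) / 2))]
      exact hiid.norm.mul_const _ |>.trans (by rw [norm_zero])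
  have hsum := (hmain.add hprod).add_const ((Real.exp (-(v / 2)) : ℝ) : ℂ)
  simp only [add_zero, zero_add] at hsum
  refine hsum.congr' ?_
  filter_upwards [hev, ha2] with n ⟨h1, h2, h3⟩ ha2
  -- The full data variance `a_n² σ = (s_n/n) σ` is exactly what `τ n` lacks.
  have e1 : ((Real.exp (-(a n ^ 2 * σ / 2)) : ℝ) : ℂ) * (Real.exp (-(τ n / 2)) : ℝ) =
      (Real.exp (-(v / 2)) : ℝ) := by
    rw [← ofReal_mul, ← Real.exp_add, ha2]
    congr 2
    simp only [hτ]
    ring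
  rw [sub_mul, e1, sub_add_sub_cancel, sub_add_cancel]
  refine integral_congr_ae (Eventually.of_forall fun ω => ?_)
  simp only
  congr 3
  have e2 : ⟪u, weightedScore Θ m (poissonWeight Z U s p n ω) (data Z n ω) θ₀⟫ =
      ∑ i, poissonWeight Z U s p n ω i * x (data Z n ω i) := by
    rw [weightedScore, inner_sum]
    exact Finset.sum_congr rfl fun i _ => real_inner_smul_right _ _ _
  rw [e2, sum_poissonWeight_mul, mul_add]
  congr 1
  · simp only [hb, ha]
    rw [div_div, Real.mul_self_sqrt h3.le]
    ring
  · simp only [inclusionSum, hc, hq, Finset.mul_sum]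
    exact Finset.sum_congr rfl fun i _ => by ring

end PoissonCLT

/-! ### Tightness and Gaussian limits of linear images. -/

section Tightness

variable {Ω : Type*} [MeasurableSpace Ω] {μ : Measure Ω} [IsProbabilityMeasure μ] {d : ℕ}

/-- Sequences converging in distribution are bounded in probability. -/
lemma BoundedInProb.of_tendstoInDistribution {Ω' : Type*} [MeasurableSpace Ω'] {μ' : Measure Ω'}
    [IsProbabilityMeasure μ'] {X : ℕ → Ω → EuclideanSpace ℝ (Fin d)}
    {X' : Ω' → EuclideanSpace ℝ (Fin d)}
    (hX : TendstoInDistribution X atTop X' (fun _ => μ) μ') :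
    BoundedInProb μ (fun n ω => ‖X n ω‖) := by
  intro ε hε
  have := Measure.isProbabilityMeasure_map hX.aemeasurable_limit
  have ht := tendsto_measure_norm_gt_of_isTightMeasureSet
    (isTightMeasureSet_singleton (μ := μ'.map X'))
  simp only [Set.mem_singleton_iff, iSup_iSup_eq_left] at ht
  obtain ⟨K, hK⟩ := (ht.eventually (gt_mem_nhds (ENNReal.ofReal_pos.mpr hε))).exists
  have hcl : IsClosed {x : EuclideanSpace ℝ (Fin d) | K + 1 ≤ ‖x‖} :=
    isClosed_le continuous_const continuous_norm
  refine ⟨K + 1, ?_⟩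
  have h1 : μ' (X' ⁻¹' {x | K + 1 ≤ ‖x‖}) < ENNReal.ofReal ε := by
    rw [← Measure.map_apply_of_aemeasurable hX.aemeasurable_limit hcl.measurableSet]
    refine (measure_mono fun x hx => ?_).trans_lt hK
    exact lt_of_lt_of_le (lt_add_one K) hx
  filter_upwards [eventually_measure_closed_le hX hcl h1] with n hn
  refine (measure_mono fun ω hω => ?_).trans hn
  simp only [Set.mem_ofPred_eq, abs_norm, Set.mem_preimage] at hω ⊢
  exact hω.le

end Tightness

section SymmetricMatrix

open scoped RealInnerProductSpace Matrix

variable {d : ℕ} {H : Matrix (Fin d) (Fin d) ℝ}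

lemma inner_toEuclideanCLM_comm (hH : H.IsHermitian) (v t : EuclideanSpace ℝ (Fin d)) :
    ⟪Matrix.toEuclideanCLM (𝕜 := ℝ) H v, t⟫ = ⟪Matrix.toEuclideanCLM (𝕜 := ℝ) H t, v⟫ := by
  have hT : Hᵀ = H := by simpa using hH.eq
  rw [real_inner_comm, Matrix.inner_toEuclideanCLM, real_inner_comm, Matrix.inner_toEuclideanCLM,
    Matrix.dotProduct_mulVec, ← Matrix.mulVec_transpose, hT, dotProduct_comm]

/-- Matches the sandwich covariance in direction `t` with the variance of the score in direction `-H
t`. -/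
lemma dotProduct_conj_mulVec (hH : H.IsHermitian) (Λ : Matrix (Fin d) (Fin d) ℝ)
    (t : EuclideanSpace ℝ (Fin d)) :
    t.ofLp ⬝ᵥ (H * Λ * H) *ᵥ t.ofLp = (-(Matrix.toEuclideanCLM (𝕜 := ℝ) H t)).ofLp ⬝ᵥ
      Λ *ᵥ (-(Matrix.toEuclideanCLM (𝕜 := ℝ) H t)).ofLp := by
  have hT : Hᵀ = H := by simpa using hH.eq
  rw [WithLp.ofLp_neg, Matrix.ofLp_toEuclideanCLM, Matrix.mulVec_neg, neg_dotProduct_neg,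
    ← Matrix.mulVec_mulVec, ← Matrix.mulVec_mulVec, Matrix.dotProduct_mulVec,
    ← Matrix.mulVec_transpose, hT]

end SymmetricMatrix

section GaussianLimit

open scoped RealInnerProductSpace Matrix
open Complex (I)

variable {Ω : Type*} [MeasurableSpace Ω] {μ : Measure Ω} [IsProbabilityMeasure μ] {d : ℕ}

/-- Convergence in distribution to a Gaussian law of linear images of a sequence of vectors. -/
lemma tendstoInDistribution_multivariateGaussian_of_charFun {W : ℕ → Ω → EuclideanSpace ℝ (Fin d)}
    {S : Matrix (Fin d) (Fin d) ℝ} (hS : S.PosSemidef)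
    {L : EuclideanSpace ℝ (Fin d) →L[ℝ] EuclideanSpace ℝ (Fin d)}
    (hL : ∀ v t, ⟪L v, t⟫ = ⟪L t, v⟫) {c : ℕ → ℝ} (hW : ∀ n, AEMeasurable (W n) μ)
    (h : ∀ t : EuclideanSpace ℝ (Fin d), Tendsto
      (fun n => ∫ ω, Complex.exp ((c n * ⟪-(L t), W n ω⟫ : ℝ) * I) ∂μ) atTop
      (𝓝 (Real.exp (-((t.ofLp ⬝ᵥ S *ᵥ t.ofLp) / 2)) : ℝ))) :
    TendstoInDistribution (fun n ω => -(L (c n • W n ω))) atTop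
      (id : EuclideanSpace ℝ (Fin d) → EuclideanSpace ℝ (Fin d)) (fun _ => μ)
      (multivariateGaussian 0 S) := by
  have hmeas : ∀ n, AEMeasurable (fun ω => -(L (c n • W n ω))) μ := by
    intro n
    have hc : Continuous fun w => -(L (c n • w)) := by fun_prop
    exact hc.measurable.comp_aemeasurable (hW n)
  refine ⟨hmeas, aemeasurable_id, ProbabilityMeasure.tendsto_iff_tendsto_charFun.mpr fun t => ?_⟩
  simp only [ProbabilityMeasure.coe_mk, Measure.map_id]
  have hlim : charFun (multivariateGaussian 0 S) t =
      (Real.exp (-((t.ofLp ⬝ᵥ S *ᵥ t.ofLp) / 2)) : ℝ) := by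
    rw [charFun_multivariateGaussian hS]
    simp
  rw [hlim]
  refine (h t).congr fun n => ?_
  rw [charFun_apply, integral_map (hmeas n) (by fun_prop)]
  refine integral_congr_ae (Eventually.of_forall fun ω => ?_)
  simp only
  congr 3
  rw [inner_neg_left, inner_neg_left, map_smul, real_inner_smul_left, hL]
  ring

end GaussianLimit

section PoissonNormality

open scoped RealInnerProductSpace Matrix
open Complex (I)

variable {𝒵 Ω : Type*} [MeasurableSpace 𝒵] [MeasurableSpace Ω] {μ : Measure Ω}
  [IsProbabilityMeasure μ] {P : Measure 𝒵} [IsProbabilityMeasure P] {d : ℕ}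
  {Θ : Set (EuclideanSpace ℝ (Fin d))} {m : 𝒵 → EuclideanSpace ℝ (Fin d) → ℝ}
  {θ₀ : EuclideanSpace ℝ (Fin d)} {Z : ℕ → Ω → 𝒵} {U : (n : ℕ) → Fin n → Ω → ℝ}
  {s : ℕ → ℝ} {p : (n : ℕ) → (Fin n → 𝒵) → Fin n → ℝ}

/-- Asymptotic normality of linear images of the inverse probability weighted score. -/
lemma IsSamplingScheme.tendstoInDistribution_weightedScore (h : IsSamplingScheme μ P Z U)
    (hs : Tendsto s atTop atTop) (hsn : ∀ᶠ n : ℕ in atTop, s n < n)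
    (hp : IsPoissonDistribution s p)
    (hm : ConcaveTarget P Θ m) (hθ₀ : IsTrueParameter P Θ m θ₀) (hHess : HessianRegular P Θ m)
    (hScore : ScoreRegular P Θ m)
    (hF : BoundedInProb μ (fun n ω => scoreFourth Θ m (data Z n ω) θ₀))
    (hπ : BoundedInProb μ fun n ω => ⨆ i : Fin n, ((n : ℝ) * p n (data Z n ω) i)⁻¹)
    {Λπ : Matrix (Fin d) (Fin d) ℝ} (hΛπ : Λπ.PosDef)
    (hΛ : ∀ k l, TendstoInMeasure μ
      (fun n ω => lambdaR Θ m (p n (data Z n ω)) (data Z n ω) θ₀ k l) atTop (fun _ => Λπ k l))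
    {H : Matrix (Fin d) (Fin d) ℝ} (hH : H.IsHermitian) :
    TendstoInDistribution (fun n ω => -(Matrix.toEuclideanCLM (𝕜 := ℝ) H
      (√(s n) • weightedScore Θ m (poissonWeight Z U s p n ω) (data Z n ω) θ₀))) atTop
      (id : EuclideanSpace ℝ (Fin d) → EuclideanSpace ℝ (Fin d)) (fun _ => μ)
      (multivariateGaussian 0 (H * Λπ * H)) := by
  have hS : (H * Λπ * H).PosSemidef := by
    have := hΛπ.posSemidef.mul_mul_conjTranspose_same H
    rwa [hH.eq] at this
  refine tendstoInDistribution_multivariateGaussian_of_charFun hS (inner_toEuclideanCLM_comm hH)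
    (h.aemeasurable_weightedScore hp hScore (interior_subset hθ₀.mem_interior)) fun t => ?_
  rw [dotProduct_conj_mulVec hH Λπ]
  exact h.tendsto_integral_exp_inner_weightedScore hs hsn hp hm hθ₀ hHess hScore hF hπ hΛ _

end PoissonNormality

/-! ### Negligibility of the linearization remainder. -/

section Remainder

variable {Ω : Type*} [MeasurableSpace Ω] {μ : Measure Ω} {d : ℕ}

/-- A linearized estimating equation determines the estimator up to a negligible remainder. -/
lemma tendstoInMeasure_of_linearization
    {A B : EuclideanSpace ℝ (Fin d) →L[ℝ] EuclideanSpace ℝ (Fin d)}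
    (hAB : ∀ v, A (B v) = v) (hBA : ∀ v, B (A v) = v) {s : ℕ → ℝ} (hs : Tendsto s atTop atTop)
    {θ₀ : EuclideanSpace ℝ (Fin d)} {θn g : ℕ → Ω → EuclideanSpace ℝ (Fin d)} {lam R : ℝ}
    (hlam : 0 < lam) (hR : 0 ≤ R)
    (hY : BoundedInProb μ fun n ω => ‖-(B (√(s n) • g n ω))‖)
    (hlin : ∀ ρ : ℝ, 0 < ρ → Tendsto (fun n => μ {ω | ¬ (‖θn n ω - θ₀‖ ≤ 2 / lam * ‖g n ω‖ ∧
      ‖g n ω + A (θn n ω - θ₀)‖ ≤ (R * ‖θn n ω - θ₀‖ + ρ) * ‖θn n ω - θ₀‖)}) atTop (𝓝 0)) :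
    TendstoInMeasure μ ((fun n ω => √(s n) • (θn n ω - θ₀)) -
      fun n ω => -(B (√(s n) • g n ω))) atTop 0 := by
  rw [tendstoInMeasure_iff_norm]
  intro δ hδ
  rw [ENNReal.tendsto_nhds_zero]
  intro ε hε
  obtain ⟨e, he, hle⟩ : ∃ e : ℝ, 0 < e ∧ ENNReal.ofReal (2 * e) ≤ ε := by
    rcases eq_or_ne ε ⊤ with rfl | h
    · exact ⟨1, one_pos, le_top⟩
    · exact ⟨ε.toReal / 2, half_pos (ENNReal.toReal_pos hε.ne' h),
        by rw [mul_div_cancel₀ _ two_ne_zero]; simp [h]⟩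
  obtain ⟨K₀, hK₀⟩ := hY e he
  set K := |K₀| with hK
  -- On the good event `‖B (√s g)‖ ≤ K`, so `√s ‖g‖ ≤ ‖A‖ K` and `√s ‖θn - θ₀‖ ≤ C`.
  set C : ℝ := 2 / lam * (‖A‖ * K) with hC
  have hC0 : 0 ≤ C := by positivity
  -- With this choice the term linear in `ρ` contributes at most `δ/4`; the quadratic term carries
  -- an extra `1/√s`.
  set ρ : ℝ := δ / (4 * (‖B‖ * C + 1)) with hρ
  have hBC : 0 < ‖B‖ * C + 1 := by positivity
  have hρ0 : 0 < ρ := by positivity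
  have hsmall : ∀ᶠ n in atTop, ‖B‖ * (R * C * C) * (√(s n))⁻¹ < δ / 2 := by
    have h1 : Tendsto (fun n => ‖B‖ * (R * C * C) * (√(s n))⁻¹) atTop (𝓝 0) := by
      rw [← mul_zero (‖B‖ * (R * C * C))]
      exact (tendsto_inv_atTop_zero.comp (Real.tendsto_sqrt_atTop.comp hs)).const_mul _
    exact h1.eventually (gt_mem_nhds (half_pos hδ))
  have hbad := (hlin ρ hρ0).eventually
    (ge_mem_nhds (show (0 : ENNReal) < ENNReal.ofReal e by simpa using he))
  filter_upwards [hK₀, hsmall, hbad, hs.eventually_gt_atTop 0] with n h1 h2 h3 hsn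
  refine le_trans ?_ ((add_le_add h1 h3).trans (le_trans (le_of_eq ?_) hle))
  swap
  · rw [← ENNReal.ofReal_add he.le he.le, two_mul]
  refine (measure_mono fun ω hω => ?_).trans (measure_union_le _ _)
  by_contra hc
  simp only [Set.mem_union, not_or, Set.mem_ofPred_eq, not_not, not_lt, abs_norm] at hc hω
  obtain ⟨c1, c2, c3⟩ := hc
  refine absurd hω (not_le.mpr ?_)
  set σ := √(s n) with hσ
  have hσ0 : 0 < σ := Real.sqrt_pos.mpr hsn
  set v := θn n ω - θ₀ with hv
  have hg : σ * ‖g n ω‖ ≤ ‖A‖ * K := by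
    have e1 : ‖σ • g n ω‖ ≤ ‖A‖ * ‖B (σ • g n ω)‖ := by
      conv_lhs => rw [← hAB (σ • g n ω)]
      exact A.le_opNorm _
    rw [norm_smul, Real.norm_of_nonneg hσ0.le] at e1
    rw [norm_neg] at c1
    refine e1.trans ?_
    gcongr
    exact c1.trans (le_abs_self _)
  have hvC : σ * ‖v‖ ≤ C := by
    calc σ * ‖v‖ ≤ σ * (2 / lam * ‖g n ω‖) := by gcongr
      _ = 2 / lam * (σ * ‖g n ω‖) := by ring
      _ ≤ C := by rw [hC]; gcongr
  have e2 : σ • v - -(B (σ • g n ω)) = B (σ • (g n ω + A v)) := by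
    rw [smul_add, map_add, ← map_smul A, hBA]
    abel
  have hBv : ‖B‖ * (σ * ((R * ‖v‖ + ρ) * ‖v‖)) ≤
      ‖B‖ * (R * C * C) * σ⁻¹ + ρ * (‖B‖ * C) := by
    have e3 : σ * ((R * ‖v‖ + ρ) * ‖v‖) =
        R * (σ * ‖v‖) * (σ * ‖v‖) * σ⁻¹ + ρ * (σ * ‖v‖) := by field_simp
    rw [e3]
    calc _ ≤ ‖B‖ * (R * C * C * σ⁻¹ + ρ * C) := by gcongr
      _ = _ := by ring
  have hρle : ρ * (‖B‖ * C) ≤ δ / 4 := by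
    rw [hρ, div_mul_eq_mul_div, div_le_iff₀ (by positivity)]
    nlinarith
  calc _ = ‖B (σ • (g n ω + A v))‖ := by
        rw [← e2]; simp [hσ, hv]
    _ ≤ ‖B‖ * (σ * ‖g n ω + A v‖) := by
        refine (B.le_opNorm _).trans (le_of_eq ?_)
        rw [norm_smul, Real.norm_of_nonneg hσ0.le]
    _ ≤ ‖B‖ * (σ * ((R * ‖v‖ + ρ) * ‖v‖)) := by gcongr
    _ < δ := by linarith

end Remainder

end Subsampling

end

/-! ### Conclusion. -/

open Subsampling in
theorem theorem2 {𝒵 Ω : Type*} [MeasurableSpace 𝒵] [MeasurableSpace Ω]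
    (μ : Measure Ω) [IsProbabilityMeasure μ] (P : Measure 𝒵) [IsProbabilityMeasure P]
    {d : ℕ} (Θ : Set (EuclideanSpace ℝ (Fin d)))
    (m : 𝒵 → EuclideanSpace ℝ (Fin d) → ℝ) (θ₀ : EuclideanSpace ℝ (Fin d))
    -- the data, the uniform random numbers, the expected subsample sizes, the probabilities
    (Z : ℕ → Ω → 𝒵) (U : (n : ℕ) → Fin n → Ω → ℝ) (hZU : IsSamplingScheme μ P Z U)
    (s : ℕ → ℝ) (hs : Tendsto s atTop atTop) (hsn : ∀ᶠ n : ℕ in atTop, s n < n)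
    (p : (n : ℕ) → (Fin n → 𝒵) → Fin n → ℝ) (hp : IsPoissonDistribution s p)
    -- the full data estimator and the Poisson subsampling estimator
    (θhat : ℕ → Ω → EuclideanSpace ℝ (Fin d)) (hθhat_meas : ∀ n, AEMeasurable (θhat n) μ)
    (hθhat : ∀ n, ∀ᵐ ω ∂μ, IsArgmax Θ (fullTarget m (data Z n ω)) (θhat n ω))
    (θtilde : ℕ → Ω → EuclideanSpace ℝ (Fin d)) (hθtilde_meas : ∀ n, AEMeasurable (θtilde n) μ)
    (hθtilde : ∀ n, ∀ᵐ ω ∂μ, IsArgmax Θ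
      (poissonTarget m (s n) (p n (data Z n ω)) (fun i => U n i ω) (data Z n ω)) (θtilde n ω))
    -- regularity assumptions
    (hΘ : IsCompact Θ)
    (hm : ConcaveTarget P Θ m) (hθ₀ : IsTrueParameter P Θ m θ₀)
    (hHess : HessianRegular P Θ m) (hScore : ScoreRegular P Θ m)
    (hFourth : ∃ δ : ℝ, 0 < δ ∧ ∀ θ ∈ Θ, BoundedInProb μ fun n =>
      {ω | dist θ (θhat n ω) < δ}.indicator fun ω => scoreFourth Θ m (data Z n ω) θ)
    (hπ : BoundedInProb μ fun n ω => ⨆ i : Fin n, ((n : ℝ) * p n (data Z n ω) i)⁻¹)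
    -- convergence in probability of `Λ_{n,R}(θ₀)`
    (Λπ : Matrix (Fin d) (Fin d) ℝ) (hΛπ : Λπ.PosDef)
    (hΛ : ∀ k l, TendstoInMeasure μ
      (fun n ω => lambdaR Θ m (p n (data Z n ω)) (data Z n ω) θ₀ k l) atTop (fun _ => Λπ k l)) :
    TendstoInDistribution (fun n ω => √(s n) • (θtilde n ω - θ₀)) atTop
      (id : EuclideanSpace ℝ (Fin d) → EuclideanSpace ℝ (Fin d)) (fun _ => μ)
      (multivariateGaussian 0
        ((hessian Θ (popTarget P m) θ₀)⁻¹ * Λπ * (hessian Θ (popTarget P m) θ₀)⁻¹)) := by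
  have hint := hθ₀.mem_interior
  set H := hessian Θ (popTarget P m) θ₀ with hHdef
  have hHneg : (-H).PosDef := by
    rw [hHdef, hessian_popTarget hm hHess hScore hint]
    exact hHess.posDef θ₀ (interior_subset hint)
  -- Symmetry of the Hessian comes with positive definiteness of `-H`.
  have hHherm : H.IsHermitian := by simpa using hHneg.isHermitian.neg
  have hHunit : IsUnit H.det := by
    rw [← Matrix.isUnit_iff_isUnit_det]
    simpa using hHneg.isUnit.neg
  have hinv : ∀ {A B : Matrix (Fin d) (Fin d) ℝ}, A * B = 1 → ∀ v,
      Matrix.toEuclideanCLM (𝕜 := ℝ) A (Matrix.toEuclideanCLM (𝕜 := ℝ) B v) = v := by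
    intro A B hAB v
    have := congrArg (fun L => L v) (map_mul (Matrix.toEuclideanCLM (n := Fin d) (𝕜 := ℝ)) A B)
    rw [hAB, map_one] at this
    exact this.symm
  have hF := hZU.boundedInProb_scoreFourth hm hθ₀ hHess hScore hθhat hFourth
  have hY := hZU.tendstoInDistribution_weightedScore hs hsn hp hm hθ₀ hHess hScore hF hπ hΛπ hΛ
    hHherm.inv
  obtain ⟨lam, R, hlam, hR, hlin⟩ := (hZU.weightedLLN_poisson hp hs hπ).linearization hm hθ₀ hHess
    hScore (hZU.tendsto_measure_not_isArgmax hp hs hθtilde)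
  rw [← toEuclideanCLM_hessian] at hlin
  -- Slutsky: `√s (θtilde - θ₀)` differs from `-H⁻¹ (√s g)` by a term vanishing in probability.
  refine tendstoInDistribution_of_tendstoInMeasure_sub _ _ hY
    (tendstoInMeasure_of_linearization (hinv (Matrix.mul_nonsing_inv H hHunit))
      (hinv (Matrix.nonsing_inv_mul H hHunit)) hs hlam hR
      (BoundedInProb.of_tendstoInDistribution hY) hlin) fun n => ?_
  exact ((hθtilde_meas n).sub_const θ₀).const_smul (√(s n))
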